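/- Let $K$ be an algebraically closed field. A $K$-coalgebra $C$ is *colocal* if its coradical $C_0$ (the sum of its simple subcoalgebras) is a simple coalgebra, and *pointed colocal* (connected) if $C_0=Kg$ with $g$ grouplike. For a pointed colocal coalgebra $(C,\Delta,\varepsilon)$ with $C_0=Kg$, let $\mathcal L(C)$ be a set of representatives for the isomorphism types of indecomposable finite-dimensional right $C$-comodules. For $(M,\rho_M)\in\mathcal L(C)$ let $A_M$ be the coalgebra dual to the finite-dimensional algebra $\mathrm{End}(M^C)$ of comodule endomorphisms of $M$ with the opposite composition as multiplication; it has exactly one grouplike element $g_M$. The right action of this algebra on $M$ makes $M$ a left $A_M$-comodule, with coaction $r_M:M\to A_M\otimes M$. Let $$C^\sim=C\oplus\bigoplus_{M\in\mathcal L(C)}(A_M\oplus M)$$ be the coalgebra whose comultiplication and counit extend those of $C$ and of the $A_M$ and are given on $m\in M$ by $\delta(m)=r_M(m)+\rho_M(m)\in A_M\otimes M+M\otimes C$ and $e(m)=0$. Let $I$ be the coideal of $C^\sim$ spanned by the elements $g-g_M$, $M\in\mathcal L(C)$, and put $C^\vee=C^\sim/I$, with the canonical coalgebra morphism $C\to C^\sim\to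 C^\vee$. **Theorem.** Let $C$ be a pointed colocal coalgebra over $K$. Put $C^{[0]}=C$, $C^{[n+1]}=(C^{[n]})^\vee$ for $n\ge 0$ (for any choice of the sets of representatives), and let $C_\infty^\vee=\bigcup_n C^{[n]}$ be the direct limit of the $C^{[n]}$ along the canonical morphisms. Then the canonical maps $C^{[n]}\to C_\infty^\vee$ are injective, the coalgebra $C_\infty^\vee$ is colocal (and pointed colocal), and every indecomposable finite-dimensional right $C_\infty^\vee$-comodule is a quotient of $C_\infty^\vee$ as a right $C_\infty^\vee$-comodule. Consequently $C_\infty^\vee$ has the right generating condition: every right $C_\infty^\vee$-comodule is a quotient of a direct sum of copies of $C_\infty^\vee$. -/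

import Mathlib

open scoped TensorProduct DirectSum

universe u

namespace CoalgGen

noncomputable section

/-! ### Right comodules -/

/-- A right comodule `(M, ρ)` over a `K`-coalgebra `C`. -/
class RightComodule (K C M : Type u) [Field K] [AddCommGroup C] [Module K C] [Coalgebra K C]
    [AddCommGroup M] [Module K M] where
  /-- The coaction `ρ : M → M ⊗ C`. -/
  coact : M →ₗ[K] M ⊗[K] C
  coassoc : (TensorProduct.assoc K M C C).toLinearMap ∘ₗ coact.rTensor C ∘ₗ coact
    = (Coalgebra.comul (R := K) (A := C)).lTensor M ∘ₗ coact
  counit_coact : (Coalgebra.counit (R := K) (A := C)).lTensor M ∘ₗ coact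
    = (TensorProduct.mk K M K).flip 1

section Comodules

variable (K C : Type u) [Field K] [AddCommGroup C] [Module K C] [Coalgebra K C]

/-- The coaction of a right comodule, with explicit arguments. -/
abbrev coact (M : Type u) [AddCommGroup M] [Module K M] [RightComodule K C M] :
    M →ₗ[K] M ⊗[K] C :=
  RightComodule.coact

/-- `C` as a right comodule over itself. -/
instance regularComodule : RightComodule K C C where
  coact := Coalgebra.comul
  coassoc := Coalgebra.coassoc
  counit_coact := Coalgebra.lTensor_counit_comp_comul

section Transfer

variable {K C} {M V : Type u} [AddCommGroup M] [Module K M] [RightComodule K C M]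
  [AddCommGroup V] [Module K V]

theorem coassoc_comp {f : M →ₗ[K] V} {ρ : V →ₗ[K] V ⊗[K] C}
    (h : ρ ∘ₗ f = f.rTensor C ∘ₗ coact K C M) :
    ((TensorProduct.assoc K V C C).toLinearMap ∘ₗ ρ.rTensor C ∘ₗ ρ) ∘ₗ f
      = ((Coalgebra.comul (R := K) (A := C)).lTensor V ∘ₗ ρ) ∘ₗ f := by
  have h1 : (TensorProduct.assoc K V C C).toLinearMap ∘ₗ (f.rTensor C).rTensor C
      = f.rTensor (C ⊗[K] C) ∘ₗ (TensorProduct.assoc K M C C).toLinearMap := by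
    ext x y z; simp
  have h2 : (Coalgebra.comul (R := K) (A := C)).lTensor V ∘ₗ f.rTensor C
      = f.rTensor (C ⊗[K] C) ∘ₗ (Coalgebra.comul (R := K) (A := C)).lTensor M := by
    ext x y; simp
  calc _ = (TensorProduct.assoc K V C C).toLinearMap ∘ₗ ρ.rTensor C ∘ₗ f.rTensor C
        ∘ₗ coact K C M := by rw [← h]; rfl
    _ = (TensorProduct.assoc K V C C).toLinearMap ∘ₗ (ρ ∘ₗ f).rTensor C ∘ₗ coact K C M := by
        rw [LinearMap.rTensor_comp]; rfl
    _ = ((TensorProduct.assoc K V C C).toLinearMap ∘ₗ (f.rTensor C).rTensor C) ∘ₗ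
          (coact K C M).rTensor C ∘ₗ coact K C M := by
        rw [h, LinearMap.rTensor_comp]; rfl
    _ = f.rTensor (C ⊗[K] C) ∘ₗ ((TensorProduct.assoc K M C C).toLinearMap ∘ₗ
          (coact K C M).rTensor C ∘ₗ coact K C M) := by rw [h1]; rfl
    _ = (f.rTensor (C ⊗[K] C) ∘ₗ (Coalgebra.comul (R := K) (A := C)).lTensor M) ∘ₗ
          coact K C M := by rw [RightComodule.coassoc]; rfl
    _ = (Coalgebra.comul (R := K) (A := C)).lTensor V ∘ₗ (f.rTensor C ∘ₗ coact K C M) := by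
        rw [← h2]; rfl
    _ = _ := by rw [← h]; rfl

theorem counit_comp {f : M →ₗ[K] V} {ρ : V →ₗ[K] V ⊗[K] C}
    (h : ρ ∘ₗ f = f.rTensor C ∘ₗ coact K C M) :
    ((Coalgebra.counit (R := K) (A := C)).lTensor V ∘ₗ ρ) ∘ₗ f
      = (TensorProduct.mk K V K).flip 1 ∘ₗ f := by
  have h2 : (Coalgebra.counit (R := K) (A := C)).lTensor V ∘ₗ f.rTensor C
      = f.rTensor K ∘ₗ (Coalgebra.counit (R := K) (A := C)).lTensor M := by
    ext x y; simp
  rw [LinearMap.comp_assoc, h, ← LinearMap.comp_assoc, h2, LinearMap.comp_assoc,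
    RightComodule.counit_coact]
  ext x; simp

end Transfer

/-- The coaction on a direct sum `M^(ι)` of copies of `M`, which is the coaction of `M` on each
copy. -/
instance copowerComodule (ι M : Type u) [AddCommGroup M] [Module K M] [RightComodule K C M] :
    RightComodule K C (ι →₀ M) where
  coact := Finsupp.lsum K fun i => (Finsupp.lsingle i).rTensor C ∘ₗ coact K C M
  coassoc := by
    ext i : 1
    exact coassoc_comp (by ext m; simp)
  counit_coact := by
    ext i : 1
    exact counit_comp (by ext m; simp)

variable {M N : Type u} [AddCommGroup M] [Module K M] [RightComodule K C M]
  [AddCommGroup N] [Module K N] [RightComodule K C N]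

variable {K} in
/-- Morphisms of right `C`-comodules. -/
def IsComoduleHom (f : M →ₗ[K] N) : Prop :=
  coact K C N ∘ₗ f = f.rTensor C ∘ₗ coact K C M

variable {K} in
/-- Subcomodules: `ρ(P) ⊆ P ⊗ C`. -/
def IsSubcomodule (P : Submodule K M) : Prop :=
  ∀ x ∈ P, coact K C M x ∈ LinearMap.range (P.subtype.rTensor C)

variable (M N) in
/-- `M` and `N` are isomorphic right `C`-comodules. -/
def ComoduleIso : Prop :=
  ∃ e : M ≃ₗ[K] N, IsComoduleHom C e.toLinearMap

variable (M N) in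
/-- `N` is a quotient of `M` as a right `C`-comodule. -/
def IsQuotientComodule : Prop :=
  ∃ f : M →ₗ[K] N, IsComoduleHom C f ∧ Function.Surjective f

variable (M) in
/-- A nonzero comodule which is not the direct sum of two nonzero subcomodules. -/
def IsIndecomposable : Prop :=
  Nontrivial M ∧ ∀ P Q : Submodule K M, IsSubcomodule C P → IsSubcomodule C Q →
    IsCompl P Q → P = ⊥ ∨ Q = ⊥

/-- The right generating condition: `C` generates all its right comodules, that is, every right
`C`-comodule is a quotient of a direct sum of copies of `C`. -/
def RightGeneratingCondition : Prop :=
  ∀ (M : Type u) [AddCommGroup M] [Module K M] [RightComodule K C M],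
    ∃ ι : Type u, IsQuotientComodule K C (ι →₀ C) M

/-! ### The coradical -/

variable {C} in
/-- Subcoalgebras: `Δ(D) ⊆ D ⊗ D`. -/
def IsSubcoalgebra (D : Submodule K C) : Prop :=
  ∀ x ∈ D, Coalgebra.comul (R := K) x ∈
    LinearMap.range (TensorProduct.map D.subtype D.subtype)

variable {C} in
/-- A nonzero subcoalgebra without proper nonzero subcoalgebras. -/
def IsSimpleSubcoalgebra (D : Submodule K C) : Prop :=
  IsSubcoalgebra K D ∧ D ≠ ⊥ ∧ ∀ D' : Submodule K C, IsSubcoalgebra K D' → D' ≤ D →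
    D' = ⊥ ∨ D' = D

/-- The coradical `C₀`: the sum of all simple subcoalgebras. -/
def coradical : Submodule K C :=
  sSup {D | IsSimpleSubcoalgebra K D}

/-- A coalgebra is colocal if its coradical is a simple coalgebra. -/
def IsColocal : Prop :=
  IsSimpleSubcoalgebra K (coradical K C)

/-- A coalgebra is pointed colocal (connected) if its coradical is `K g` with `g` grouplike. -/
def IsPointedColocal : Prop :=
  ∃ g : C, IsGroupLikeElem K g ∧ coradical K C = K ∙ g

end Comodules

/-! ### Representatives of the indecomposable finite dimensional comodules -/

/-- A set of representatives for the isomorphism types of indecomposable finite dimensional right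
`C`-comodules: a family `(M i)` of such comodules in which every isomorphism type occurs exactly
once. -/
structure IndecReps (K C : Type u) [Field K] [AddCommGroup C] [Module K C] [Coalgebra K C] where
  ι : Type u
  M : ι → Type u
  [addCommGroup : ∀ i, AddCommGroup (M i)]
  [module : ∀ i, Module K (M i)]
  [comodule : ∀ i, RightComodule K C (M i)]
  finite : ∀ i, Module.Finite K (M i)
  indecomposable : ∀ i, IsIndecomposable K C (M i)
  eq_of_iso : ∀ i j, ComoduleIso K C (M i) (M j) → i = j
  exists_iso : ∀ (N : Type u) [AddCommGroup N] [Module K N] [RightComodule K C N],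
    Module.Finite K N → IsIndecomposable K C N → ∃ i, ComoduleIso K C N (M i)

attribute [instance] IndecReps.addCommGroup IndecReps.module IndecReps.comodule IndecReps.finite

section Existence

variable {K C : Type u} [Field K] [AddCommGroup C] [Module K C] [Coalgebra K C]

theorem ComoduleIso.refl (M : Type u) [AddCommGroup M] [Module K M] [RightComodule K C M] :
    ComoduleIso K C M M :=
  ⟨LinearEquiv.refl K M, by
    show coact K C M ∘ₗ LinearMap.id = LinearMap.rTensor C LinearMap.id ∘ₗ coact K C M
    rw [LinearMap.rTensor_id]; rfl⟩

variable {M N P : Type u} [AddCommGroup M] [Module K M] [RightComodule K C M]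
  [AddCommGroup N] [Module K N] [RightComodule K C N]
  [AddCommGroup P] [Module K P] [RightComodule K C P]

theorem IsComoduleHom.symm {e : M ≃ₗ[K] N} (h : IsComoduleHom C e.toLinearMap) :
    IsComoduleHom C e.symm.toLinearMap := by
  unfold IsComoduleHom at *
  have h1 := congrArg (fun f => e.symm.toLinearMap.rTensor C ∘ₗ f ∘ₗ e.symm.toLinearMap) h
  simp only [LinearMap.comp_assoc] at h1
  rw [LinearEquiv.comp_symm, LinearMap.comp_id] at h1
  rw [h1, ← LinearMap.comp_assoc, ← LinearMap.rTensor_comp, LinearEquiv.symm_comp,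
    LinearMap.rTensor_id, LinearMap.id_comp]

theorem ComoduleIso.symm (h : ComoduleIso K C M N) : ComoduleIso K C N M :=
  let ⟨e, he⟩ := h
  ⟨e.symm, he.symm⟩

theorem IsComoduleHom.comp {g : N →ₗ[K] P} {f : M →ₗ[K] N} (hg : IsComoduleHom C g)
    (hf : IsComoduleHom C f) : IsComoduleHom C (g ∘ₗ f) := by
  unfold IsComoduleHom at *
  rw [← LinearMap.comp_assoc, hg, LinearMap.comp_assoc, hf, LinearMap.rTensor_comp,
    LinearMap.comp_assoc]

theorem ComoduleIso.trans (h : ComoduleIso K C M N) (h' : ComoduleIso K C N P) :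
    ComoduleIso K C M P :=
  let ⟨e, he⟩ := h
  let ⟨e', he'⟩ := h'
  ⟨e.trans e', he'.comp he⟩

theorem IsSubcomodule.map {f : M →ₗ[K] N} (hf : IsComoduleHom C f) {P : Submodule K M}
    (hP : IsSubcomodule C P) : IsSubcomodule C (P.map f) := by
  rintro _ ⟨x, hx, rfl⟩
  obtain ⟨t, ht⟩ := hP x hx
  refine ⟨(f.submoduleMap P).rTensor C t, ?_⟩
  have h1 : coact K C N (f x) = f.rTensor C (coact K C M x) := LinearMap.congr_fun hf x
  rw [h1, ← ht, ← LinearMap.comp_apply, ← LinearMap.comp_apply, ← LinearMap.rTensor_comp,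
    ← LinearMap.rTensor_comp]
  rfl

theorem IsIndecomposable.of_iso (h : IsIndecomposable K C M) (e : ComoduleIso K C M N) :
    IsIndecomposable K C N := by
  obtain ⟨e, he⟩ := e
  obtain ⟨h0, h1⟩ := h
  refine ⟨e.symm.toEquiv.nontrivial, fun P Q hP hQ hPQ => ?_⟩
  have := h1 (P.map e.symm.toLinearMap) (Q.map e.symm.toLinearMap) (hP.map he.symm)
    (hQ.map he.symm) (hPQ.map (Submodule.orderIsoMapComap e.symm))
  simpa [Submodule.map_eq_bot_iff] using this

/-- Transport of a comodule structure along a linear isomorphism. -/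
abbrev transport {V : Type u} [AddCommGroup V] [Module K V] (e : M ≃ₗ[K] V) :
    RightComodule K C V where
  coact := e.toLinearMap.rTensor C ∘ₗ coact K C M ∘ₗ e.symm.toLinearMap
  coassoc := by
    rw [← LinearMap.cancel_right e.surjective]
    exact coassoc_comp (f := e.toLinearMap) (by ext m; simp)
  counit_coact := by
    rw [← LinearMap.cancel_right e.surjective]
    exact counit_comp (f := e.toLinearMap) (by ext m; simp)

variable (K C) in
/-- Sets of representatives exist. -/
instance indecReps_nonempty : Nonempty (IndecReps K C) := by
  classical
  let X : Type u := Σ n : ℕ, {c : RightComodule K C (Fin n → K) //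
    IsIndecomposable K C (Fin n → K)}
  let inst : ∀ x : X, RightComodule K C (Fin x.1 → K) := fun x => x.2.1
  let s : Setoid X :=
    { r := fun x y => ComoduleIso K C (Fin x.1 → K) (Fin y.1 → K)
      iseqv := ⟨fun x => ComoduleIso.refl _, fun h => h.symm, fun h h' => h.trans h'⟩ }
  refine ⟨{
    ι := Quotient s
    M := fun q => Fin q.out.1 → K
    comodule := fun q => q.out.2.1
    finite := fun q => inferInstance
    indecomposable := fun q => q.out.2.2
    eq_of_iso := fun q q' h => ?_
    exists_iso := fun N _ _ _ _ hN => ?_ }⟩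
  · rw [← Quotient.out_eq q, ← Quotient.out_eq q']
    exact Quotient.sound h
  · let e := (Module.finBasis K N).equivFun
    let c : RightComodule K C (Fin (Module.finrank K N) → K) := transport e
    have he : IsComoduleHom C e.toLinearMap := by
      unfold IsComoduleHom
      show (e.toLinearMap.rTensor C ∘ₗ coact K C N ∘ₗ e.symm.toLinearMap) ∘ₗ e.toLinearMap = _
      simp only [LinearMap.comp_assoc]
      rw [LinearEquiv.symm_comp, LinearMap.comp_id]
    let x : X := ⟨_, c, hN.of_iso ⟨e, he⟩⟩
    refine ⟨Quotient.mk s x, ?_⟩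
    have h1 : ComoduleIso K C N (Fin x.1 → K) := ⟨e, he⟩
    have h2 : ComoduleIso K C (Fin x.1 → K) (Fin (Quotient.mk s x).out.1 → K) :=
      s.symm (Quotient.mk_out (s := s) x)
    exact h1.trans h2

end Existence

/-! ### The coalgebra dual to a finite dimensional algebra -/

section Dual

variable (K E : Type u) [Field K] [Ring E] [Algebra K E]

open Module (Dual)

/-- The counit of `E^*`: evaluation at `1`. -/
def dualCounit : Dual K E →ₗ[K] K :=
  Dual.eval K E 1

variable {K E} in
theorem counit_of_action {V : Type u} [AddCommMonoid V] [Module K V]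
    (r : V →ₗ[K] Dual K E ⊗[K] V)
    (h : ∀ v, dualTensorHom K E V (r v) 1 = v) :
    (dualCounit K E).rTensor V ∘ₗ r = TensorProduct.mk K K V 1 := by
  ext v
  apply (TensorProduct.lid K V).injective
  have h1 : ∀ t : Dual K E ⊗[K] V,
      TensorProduct.lid K V ((dualCounit K E).rTensor V t) = dualTensorHom K E V t 1 := by
    intro t
    induction t with
    | zero => simp
    | tmul b c => simp [dualCounit]
    | add s t hs ht => simp only [map_add, LinearMap.add_apply, hs, ht]
  rw [LinearMap.comp_apply, h1, h]
  simp

variable [Module.Finite K E]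

/-- The comultiplication of `E^*`: `δ(a) = a₁ ⊗ a₂` where `a(x y) = a₁(x) a₂(y)`. -/
def dualComul : Dual K E →ₗ[K] Dual K E ⊗[K] Dual K E :=
  (TensorProduct.dualDistribEquiv K E E).symm.toLinearMap ∘ₗ (LinearMap.mul' K E).dualMap

variable {K E}

theorem dualDistrib_dualComul (a : Dual K E) (x y : E) :
    TensorProduct.dualDistrib K E E (dualComul K E a) (x ⊗ₜ y) = a (x * y) := by
  have : TensorProduct.dualDistribEquiv K E E (dualComul K E a) = (LinearMap.mul' K E).dualMap a :=
    LinearEquiv.apply_symm_apply _ _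
  exact congrArg (fun f => f (x ⊗ₜ y)) this

/-- An element of `E^* ⊗ V` is determined by the corresponding linear map `E → V`. -/
theorem dualTensorHom_inj {V : Type u} [AddCommMonoid V] [Module K V] {s t : Dual K E ⊗[K] V}
    (h : ∀ x, dualTensorHom K E V s x = dualTensorHom K E V t x) : s = t :=
  (dualTensorHomEquiv K E V).injective (by ext x; exact h x)

theorem dualTensorHom_dualComul (a : Dual K E) (x y : E) :
    dualTensorHom K E (Dual K E) (dualComul K E a) x y = a (x * y) := by
  rw [← dualDistrib_dualComul]
  generalize dualComul K E a = t
  induction t with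
  | zero => simp
  | tmul b c => simp
  | add s t hs ht => simp [hs, ht]

variable (K E) in
theorem dual_counit_left : (dualCounit K E).rTensor (Dual K E) ∘ₗ dualComul K E
    = TensorProduct.mk K K (Dual K E) 1 := by
  ext a
  apply (TensorProduct.lid K (Dual K E)).injective
  ext y
  have h := dualTensorHom_dualComul a 1 y
  rw [one_mul] at h
  simp only [LinearMap.comp_apply, TensorProduct.mk_apply, TensorProduct.lid_tmul, one_smul]
  rw [← h]
  generalize dualComul K E a = t
  induction t with
  | zero => simp
  | tmul b c => simp [dualCounit]
  | add s t hs ht => simp only [map_add, LinearMap.add_apply, hs, ht]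

variable (K E) in
theorem dual_counit_right : (dualCounit K E).lTensor (Dual K E) ∘ₗ dualComul K E
    = (TensorProduct.mk K (Dual K E) K).flip 1 := by
  ext a
  apply (TensorProduct.rid K (Dual K E)).injective
  ext x
  have h := dualTensorHom_dualComul a x 1
  rw [mul_one] at h
  simp only [LinearMap.comp_apply, LinearMap.flip_apply, TensorProduct.mk_apply,
    TensorProduct.rid_tmul, one_smul]
  rw [← h]
  generalize dualComul K E a = t
  induction t with
  | zero => simp
  | tmul b c => simp [dualCounit, mul_comm]
  | add s t hs ht => simp only [map_add, LinearMap.add_apply, hs, ht]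

variable (K E) in
/-- If `r : V → E^* ⊗ V` corresponds to a right action of `E` on `V`, then `r` is
coassociative. -/
theorem coassoc_of_action {V : Type u} [AddCommMonoid V] [Module K V] (r : V →ₗ[K] Dual K E ⊗[K] V)
    (h : ∀ v x y, dualTensorHom K E V (r v) (x * y)
      = dualTensorHom K E V (r (dualTensorHom K E V (r v) x)) y) :
    (TensorProduct.assoc K (Dual K E) (Dual K E) V).toLinearMap ∘ₗ (dualComul K E).rTensor V ∘ₗ r
      = r.lTensor (Dual K E) ∘ₗ r := by
  ext v
  apply dualTensorHom_inj
  intro x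
  apply dualTensorHom_inj
  intro y
  have h1 : ∀ t : Dual K E ⊗[K] V, dualTensorHom K E V (dualTensorHom K E (Dual K E ⊗[K] V)
      (TensorProduct.assoc K (Dual K E) (Dual K E) V ((dualComul K E).rTensor V t)) x) y
      = dualTensorHom K E V t (x * y) := by
    intro t
    induction t with
    | zero => simp
    | tmul b c =>
      rw [LinearMap.rTensor_tmul, dualTensorHom_apply, ← dualTensorHom_dualComul]
      generalize dualComul K E b = t
      induction t with
      | zero => simp
      | tmul b' c' => simp [mul_smul]
      | add s t hs ht => simp only [map_add, LinearMap.add_apply, TensorProduct.add_tmul,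
          add_smul, hs, ht]
    | add s t hs ht => simp only [map_add, LinearMap.add_apply, hs, ht]
  have h2 : ∀ t : Dual K E ⊗[K] V, dualTensorHom K E (Dual K E ⊗[K] V)
      (r.lTensor (Dual K E) t) x = r (dualTensorHom K E V t x) := by
    intro t
    induction t with
    | zero => simp
    | tmul b c => simp
    | add s t hs ht => simp only [map_add, LinearMap.add_apply, hs, ht]
  simp only [LinearMap.comp_apply, LinearEquiv.coe_coe]
  rw [h1, h2, h]

variable (K E) in
/-- The coalgebra `E^*` dual to the finite dimensional algebra `E`. -/
abbrev dualCoalgebra : Coalgebra K (Dual K E) where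
  comul := dualComul K E
  counit := dualCounit K E
  coassoc := by
    apply coassoc_of_action
    intro a x y
    ext z
    simp only [dualTensorHom_dualComul, mul_assoc]
  rTensor_counit_comp_comul := dual_counit_left K E
  lTensor_counit_comp_comul := dual_counit_right K E

theorem bicomodule_of_action {V W : Type u} [AddCommMonoid V] [Module K V]
    [AddCommMonoid W] [Module K W]
    (r : V →ₗ[K] Dual K E ⊗[K] V) (ρ : V →ₗ[K] V ⊗[K] W)
    (h : ∀ x, ρ ∘ₗ ((dualTensorHom K E V ∘ₗ r).flip x)
      = ((dualTensorHom K E V ∘ₗ r).flip x).rTensor W ∘ₗ ρ) :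
    (TensorProduct.assoc K (Dual K E) V W).toLinearMap ∘ₗ r.rTensor W ∘ₗ ρ
      = ρ.lTensor (Dual K E) ∘ₗ r := by
  ext v
  apply dualTensorHom_inj
  intro x
  have h1 : ∀ t : V ⊗[K] W, dualTensorHom K E (V ⊗[K] W)
      (TensorProduct.assoc K (Dual K E) V W (r.rTensor W t)) x
      = ((dualTensorHom K E V ∘ₗ r).flip x).rTensor W t := by
    intro t
    induction t with
    | zero => simp
    | tmul b c =>
      rw [LinearMap.rTensor_tmul, LinearMap.rTensor_tmul, LinearMap.flip_apply,
        LinearMap.comp_apply]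
      generalize r b = t
      induction t with
      | zero => simp
      | tmul b' c' => simp [TensorProduct.smul_tmul']
      | add s t hs ht => simp only [map_add, LinearMap.add_apply, TensorProduct.add_tmul, hs, ht]
    | add s t hs ht => simp only [map_add, hs, ht, LinearMap.add_apply]
  have h2 : ∀ t : Dual K E ⊗[K] V, dualTensorHom K E (V ⊗[K] W) (ρ.lTensor (Dual K E) t) x
      = ρ (dualTensorHom K E V t x) := by
    intro t
    induction t with
    | zero => simp
    | tmul b c => simp
    | add s t hs ht => simp only [map_add, LinearMap.add_apply, hs, ht]
  simp only [LinearMap.comp_apply, LinearEquiv.coe_coe]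
  rw [h1, h2]
  exact (LinearMap.congr_fun (h x) v).symm

end Dual

/-! ### The coalgebra `A_M` and the left coaction of `A_M` on `M` -/

section EndCoalgebra

variable (K C M : Type u) [Field K] [AddCommGroup C] [Module K C] [Coalgebra K C]
  [AddCommGroup M] [Module K M] [RightComodule K C M]

/-- The algebra of comodule endomorphisms of `M` (with composition as multiplication). -/
def comoduleEnd : Subalgebra K (Module.End K M) where
  carrier := {f | IsComoduleHom C f}
  mul_mem' := fun hf hg => IsComoduleHom.comp hf hg
  add_mem' := fun {f g} hf hg => by
    show coact K C M ∘ₗ (f + g) = (f + g).rTensor C ∘ₗ coact K C M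
    have hf' : coact K C M ∘ₗ f = f.rTensor C ∘ₗ coact K C M := hf
    have hg' : coact K C M ∘ₗ g = g.rTensor C ∘ₗ coact K C M := hg
    rw [LinearMap.comp_add, hf', hg', LinearMap.rTensor_add, LinearMap.add_comp]
  algebraMap_mem' := fun c => by
    show coact K C M ∘ₗ (algebraMap K (Module.End K M) c)
      = (algebraMap K (Module.End K M) c).rTensor C ∘ₗ coact K C M
    rw [Algebra.algebraMap_eq_smul_one, Module.End.one_eq_id, LinearMap.rTensor_smul,
      LinearMap.rTensor_id, LinearMap.comp_smul, LinearMap.smul_comp]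
    rfl

/-- The algebra of comodule endomorphisms of `M` with the opposite composition as multiplication;
`M` is a right module over it. -/
abbrev EndOp : Type u := (comoduleEnd K C M)ᵐᵒᵖ

/-- The dual space `A_M` of the algebra of comodule endomorphisms of `M` (with the opposite
composition). -/
abbrev EndCoalg : Type u := Module.Dual K (EndOp K C M)

variable [Module.Finite K M]

instance : Module.Finite K (EndOp K C M) :=
  Module.Finite.equiv (MulOpposite.opLinearEquiv K (M := comoduleEnd K C M))

/-- `A_M` is the coalgebra dual to the finite dimensional algebra of comodule endomorphisms of
`M` (with the opposite composition). -/
instance endCoalgebra : Coalgebra K (EndCoalg K C M) :=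
  dualCoalgebra K (EndOp K C M)

/-- The right action of the endomorphism algebra on `M`, as a map `m ↦ (x ↦ m x)`. -/
def endAct : M →ₗ[K] EndOp K C M →ₗ[K] M :=
  LinearMap.flip
    ((comoduleEnd K C M).val.toLinearMap ∘ₗ
      (MulOpposite.opLinearEquiv K (M := comoduleEnd K C M)).symm.toLinearMap)

/-- The left coaction `r_M : M → A_M ⊗ M`, `r_M(m) = m₍₋₁₎ ⊗ m₍₀₎`, induced by the right action:
`m x = m₍₋₁₎(x) m₍₀₎` for all `x`. -/
def leftCoact : M →ₗ[K] EndCoalg K C M ⊗[K] M :=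
  (dualTensorHomEquiv K (EndOp K C M) M).symm.toLinearMap ∘ₗ endAct K C M

variable {K C M}

theorem dualTensorHom_leftCoact (m : M) (x : EndOp K C M) :
    dualTensorHom K (EndOp K C M) M (leftCoact K C M m) x = x.unop.1 m := by
  have : dualTensorHomEquiv K (EndOp K C M) M (leftCoact K C M m) = endAct K C M m :=
    LinearEquiv.apply_symm_apply _ _
  exact LinearMap.congr_fun this x

variable (K C M)

theorem leftCoact_coassoc :
    (TensorProduct.assoc K (EndCoalg K C M) (EndCoalg K C M) M).toLinearMap ∘ₗ
      (Coalgebra.comul (R := K) (A := EndCoalg K C M)).rTensor M ∘ₗ leftCoact K C M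
      = (leftCoact K C M).lTensor (EndCoalg K C M) ∘ₗ leftCoact K C M :=
  coassoc_of_action K (EndOp K C M) (leftCoact K C M) fun v x y =>
    (dualTensorHom_leftCoact v (x * y)).trans
      ((congrArg y.unop.1 (dualTensorHom_leftCoact v x)).symm.trans
        (dualTensorHom_leftCoact _ y).symm)

theorem leftCoact_counit :
    (Coalgebra.counit (R := K) (A := EndCoalg K C M)).rTensor M ∘ₗ leftCoact K C M
      = TensorProduct.mk K K M 1 :=
  counit_of_action (E := EndOp K C M) (leftCoact K C M) fun v => dualTensorHom_leftCoact v 1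

/-- The compatibility of the two coactions: `M` is an `A_M`-`C`-bicomodule. -/
theorem bicomodule :
    (TensorProduct.assoc K (EndCoalg K C M) M C).toLinearMap ∘ₗ
      (leftCoact K C M).rTensor C ∘ₗ coact K C M
      = (coact K C M).lTensor (EndCoalg K C M) ∘ₗ leftCoact K C M := by
  refine bicomodule_of_action (E := EndOp K C M) (leftCoact K C M) (coact K C M) fun x => ?_
  have h : (dualTensorHom K (EndOp K C M) M ∘ₗ leftCoact K C M).flip x = x.unop.1 := by
    ext m
    exact dualTensorHom_leftCoact m x
  exact (congrArg (fun f => coact K C M ∘ₗ f) h).trans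
    (Eq.trans x.unop.2 (congrArg (fun f => LinearMap.rTensor C f ∘ₗ coact K C M) h).symm)

end EndCoalgebra

/-! ### The coalgebra `C^~` -/

section Tilde

variable {K C : Type u} [Field K] [AddCommGroup C] [Module K C] [Coalgebra K C]
  (R : IndecReps K C)

/-- The coalgebra `A_M` of the `i`-th representative `M`. -/
abbrev IndecReps.A (i : R.ι) : Type u := EndCoalg K C (R.M i)

/-- The vector space `C^~ = C ⊕ ⨁_M (A_M ⊕ M)`. -/
def VeeTilde : Type u := C × ⨁ i, (R.A i × R.M i)

namespace VeeTilde

instance : AddCommGroup (VeeTilde R) :=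
  inferInstanceAs (AddCommGroup (C × ⨁ i, (R.A i × R.M i)))

instance : Module K (VeeTilde R) :=
  inferInstanceAs (Module K (C × ⨁ i, (R.A i × R.M i)))

/-- The inclusion of the summand `C`. -/
def inC : C →ₗ[K] VeeTilde R :=
  LinearMap.inl K C (⨁ i, (R.A i × R.M i))

open Classical in
/-- The inclusion of the summand `A_M ⊕ M`. -/
def inAM (i : R.ι) : R.A i × R.M i →ₗ[K] VeeTilde R :=
  LinearMap.inr K C (⨁ i, (R.A i × R.M i)) ∘ₗ DirectSum.lof K R.ι (fun i => R.A i × R.M i) i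

/-- The inclusion of the summand `A_M`. -/
def inA (i : R.ι) : R.A i →ₗ[K] VeeTilde R :=
  inAM R i ∘ₗ LinearMap.inl K (R.A i) (R.M i)

/-- The inclusion of the summand `M`. -/
def inM (i : R.ι) : R.M i →ₗ[K] VeeTilde R :=
  inAM R i ∘ₗ LinearMap.inr K (R.A i) (R.M i)

variable {R} {P : Type u} [AddCommMonoid P] [Module K P]

open Classical in
/-- The linear map on `C^~` with given restrictions to the summands. -/
def desc (f : C →ₗ[K] P) (a : ∀ i, R.A i →ₗ[K] P) (m : ∀ i, R.M i →ₗ[K] P) :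
    VeeTilde R →ₗ[K] P :=
  LinearMap.coprod f (DirectSum.toModule K R.ι P fun i => (a i).coprod (m i))

theorem desc_inC (f : C →ₗ[K] P) (a : ∀ i, R.A i →ₗ[K] P) (m : ∀ i, R.M i →ₗ[K] P) :
    desc f a m ∘ₗ inC R = f :=
  LinearMap.coprod_inl _ _

theorem desc_inAM (f : C →ₗ[K] P) (a : ∀ i, R.A i →ₗ[K] P) (m : ∀ i, R.M i →ₗ[K] P) (i : R.ι) :
    desc f a m ∘ₗ inAM R i = (a i).coprod (m i) := by
  classical
  apply LinearMap.ext
  intro x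
  show LinearMap.coprod f (DirectSum.toModule K R.ι P fun i => (a i).coprod (m i))
    (0, DirectSum.lof K R.ι (fun i => R.A i × R.M i) i x) = _
  rw [LinearMap.coprod_apply, map_zero, zero_add]
  convert DirectSum.toModule_lof (M := fun i => R.A i × R.M i) K i x

theorem desc_inA (f : C →ₗ[K] P) (a : ∀ i, R.A i →ₗ[K] P) (m : ∀ i, R.M i →ₗ[K] P) (i : R.ι) :
    desc f a m ∘ₗ inA R i = a i := by
  rw [inA, ← LinearMap.comp_assoc, desc_inAM, LinearMap.coprod_inl]

theorem desc_inM (f : C →ₗ[K] P) (a : ∀ i, R.A i →ₗ[K] P) (m : ∀ i, R.M i →ₗ[K] P) (i : R.ι) :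
    desc f a m ∘ₗ inM R i = m i := by
  rw [inM, ← LinearMap.comp_assoc, desc_inAM, LinearMap.coprod_inr]

theorem hom_ext {f g : VeeTilde R →ₗ[K] P} (hC : f ∘ₗ inC R = g ∘ₗ inC R)
    (hA : ∀ i, f ∘ₗ inA R i = g ∘ₗ inA R i) (hM : ∀ i, f ∘ₗ inM R i = g ∘ₗ inM R i) : f = g := by
  classical
  refine LinearMap.prod_ext hC (DirectSum.linearMap_ext K fun i => ?_)
  have h : f ∘ₗ inAM R i = g ∘ₗ inAM R i := LinearMap.prod_ext (hA i) (hM i)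
  exact h

variable (R)

/-- The comultiplication of `C^~`: `δ(c) = c₁ ⊗ c₂`, `δ(a) = a₍₁₎ ⊗ a₍₂₎` and
`δ(m) = m₍₋₁₎ ⊗ m₍₀₎ + m₀ ⊗ m₁`. -/
def comul : VeeTilde R →ₗ[K] VeeTilde R ⊗[K] VeeTilde R :=
  desc (TensorProduct.map (inC R) (inC R) ∘ₗ Coalgebra.comul)
    (fun i => TensorProduct.map (inA R i) (inA R i) ∘ₗ Coalgebra.comul)
    (fun i => TensorProduct.map (inA R i) (inM R i) ∘ₗ leftCoact K C (R.M i)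
      + TensorProduct.map (inM R i) (inC R) ∘ₗ coact K C (R.M i))

/-- The counit of `C^~`: it is the counit on `C` and on `A_M`, and zero on `M`. -/
def counit : VeeTilde R →ₗ[K] K :=
  desc Coalgebra.counit (fun _ => Coalgebra.counit) (fun _ => 0)

theorem comul_inC : comul R ∘ₗ inC R = TensorProduct.map (inC R) (inC R) ∘ₗ Coalgebra.comul :=
  desc_inC _ _ _

theorem comul_inA (i : R.ι) :
    comul R ∘ₗ inA R i = TensorProduct.map (inA R i) (inA R i) ∘ₗ Coalgebra.comul :=
  desc_inA _ _ _ i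

theorem comul_inM (i : R.ι) :
    comul R ∘ₗ inM R i = TensorProduct.map (inA R i) (inM R i) ∘ₗ leftCoact K C (R.M i)
      + TensorProduct.map (inM R i) (inC R) ∘ₗ coact K C (R.M i) :=
  desc_inM _ _ _ i

theorem counit_inC : counit R ∘ₗ inC R = Coalgebra.counit := desc_inC _ _ _

theorem counit_inA (i : R.ι) : counit R ∘ₗ inA R i = Coalgebra.counit := desc_inA _ _ _ i

theorem counit_inM (i : R.ι) : counit R ∘ₗ inM R i = 0 := desc_inM _ _ _ i

section

variable {X Y Z W S T U : Type u} [AddCommMonoid X] [Module K X] [AddCommMonoid Y] [Module K Y]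
  [AddCommMonoid Z] [Module K Z] [AddCommMonoid W] [Module K W] [AddCommMonoid S] [Module K S]
  [AddCommMonoid T] [Module K T] [AddCommMonoid U] [Module K U]

theorem assoc_left (f : X →ₗ[K] P) (g : Y →ₗ[K] P) (h : Z →ₗ[K] P) (u : S →ₗ[K] X ⊗[K] Y)
    (v : T →ₗ[K] S ⊗[K] Z) :
    (TensorProduct.assoc K P P P).toLinearMap ∘ₗ TensorProduct.map (TensorProduct.map f g ∘ₗ u) h
      ∘ₗ v = TensorProduct.map f (TensorProduct.map g h) ∘ₗ
        ((TensorProduct.assoc K X Y Z).toLinearMap ∘ₗ u.rTensor Z ∘ₗ v) := by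
  have h1 : TensorProduct.map (TensorProduct.map f g ∘ₗ u) h
      = TensorProduct.map (TensorProduct.map f g) h ∘ₗ u.rTensor Z := by
    ext x y; simp
  have h2 := TensorProduct.map_map_comp_assoc_eq f g h
  rw [h1, ← LinearMap.comp_assoc v, ← LinearMap.comp_assoc, ← LinearMap.comp_assoc, ← h2]
  rfl

theorem assoc_right (f : X →ₗ[K] P) (g : Y →ₗ[K] P) (h : Z →ₗ[K] P) (u : S →ₗ[K] Y ⊗[K] Z)
    (v : T →ₗ[K] X ⊗[K] S) :
    TensorProduct.map f (TensorProduct.map g h ∘ₗ u) ∘ₗ v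
      = TensorProduct.map f (TensorProduct.map g h) ∘ₗ (u.lTensor X ∘ₗ v) := by
  have h1 : TensorProduct.map f (TensorProduct.map g h ∘ₗ u)
      = TensorProduct.map f (TensorProduct.map g h) ∘ₗ u.lTensor X := by
    ext x y; simp
  rw [h1]
  rfl

theorem expand_left (D : P →ₗ[K] P ⊗[K] P) (f : S →ₗ[K] P) (h : Z →ₗ[K] P)
    (v : T →ₗ[K] S ⊗[K] Z) :
    D.rTensor P ∘ₗ TensorProduct.map f h ∘ₗ v = TensorProduct.map (D ∘ₗ f) h ∘ₗ v := by
  rw [← LinearMap.comp_assoc, LinearMap.rTensor_comp_map]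

theorem expand_right (D : P →ₗ[K] P ⊗[K] P) (f : X →ₗ[K] P) (h : S →ₗ[K] P)
    (v : T →ₗ[K] X ⊗[K] S) :
    D.lTensor P ∘ₗ TensorProduct.map f h ∘ₗ v = TensorProduct.map f (D ∘ₗ h) ∘ₗ v := by
  rw [← LinearMap.comp_assoc, LinearMap.lTensor_comp_map]

theorem counit_left_aux {ε : X →ₗ[K] K} (g : Y →ₗ[K] P) {v : Y →ₗ[K] X ⊗[K] Y}
    (h : ε.rTensor Y ∘ₗ v = TensorProduct.mk K K Y 1) :
    TensorProduct.map ε g ∘ₗ v = TensorProduct.mk K K P 1 ∘ₗ g := by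
  have h1 : TensorProduct.map ε g = g.lTensor K ∘ₗ ε.rTensor Y := by ext; simp
  rw [h1, LinearMap.comp_assoc, h]
  ext; simp

theorem counit_right_aux {ε : X →ₗ[K] K} (g : Y →ₗ[K] P) {v : Y →ₗ[K] Y ⊗[K] X}
    (h : ε.lTensor Y ∘ₗ v = (TensorProduct.mk K Y K).flip 1) :
    TensorProduct.map g ε ∘ₗ v = (TensorProduct.mk K P K).flip 1 ∘ₗ g := by
  have h1 : TensorProduct.map g ε = g.rTensor K ∘ₗ ε.lTensor Y := by ext; simp
  rw [h1, LinearMap.comp_assoc, h]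
  ext; simp

end

theorem coassoc :
    (TensorProduct.assoc K (VeeTilde R) (VeeTilde R) (VeeTilde R)).toLinearMap ∘ₗ
      (comul R).rTensor (VeeTilde R) ∘ₗ comul R = (comul R).lTensor (VeeTilde R) ∘ₗ comul R := by
  apply hom_ext
  · simp only [LinearMap.comp_assoc]
    rw [comul_inC, expand_left, expand_right, comul_inC, assoc_left, assoc_right, Coalgebra.coassoc]
  · intro i
    simp only [LinearMap.comp_assoc]
    rw [comul_inA, expand_left, expand_right, comul_inA, assoc_left, assoc_right, Coalgebra.coassoc]
  · intro i
    simp only [LinearMap.comp_assoc]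
    rw [comul_inM]
    simp only [LinearMap.comp_add]
    rw [expand_left, expand_left, expand_right, expand_right, comul_inA, comul_inC, comul_inM]
    simp only [TensorProduct.map_add_left, TensorProduct.map_add_right, LinearMap.add_comp,
      LinearMap.comp_add]
    rw [assoc_left, assoc_left, assoc_left, assoc_right, assoc_right, assoc_right,
      leftCoact_coassoc, bicomodule, RightComodule.coassoc, add_assoc]

theorem counit_left : (counit R).rTensor (VeeTilde R) ∘ₗ comul R
    = TensorProduct.mk K K (VeeTilde R) 1 := by
  apply hom_ext
  · rw [LinearMap.comp_assoc, comul_inC, ← LinearMap.comp_assoc, LinearMap.rTensor_comp_map,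
      counit_inC, counit_left_aux _ Coalgebra.rTensor_counit_comp_comul]
  · intro i
    rw [LinearMap.comp_assoc, comul_inA, ← LinearMap.comp_assoc, LinearMap.rTensor_comp_map,
      counit_inA, counit_left_aux _ Coalgebra.rTensor_counit_comp_comul]
  · intro i
    rw [LinearMap.comp_assoc, comul_inM, LinearMap.comp_add, ← LinearMap.comp_assoc,
      ← LinearMap.comp_assoc, LinearMap.rTensor_comp_map, LinearMap.rTensor_comp_map,
      counit_inA, counit_inM, counit_left_aux _ (leftCoact_counit K C (R.M i)),
      TensorProduct.map_zero_left, LinearMap.zero_comp, add_zero]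

theorem counit_right : (counit R).lTensor (VeeTilde R) ∘ₗ comul R
    = (TensorProduct.mk K (VeeTilde R) K).flip 1 := by
  apply hom_ext
  · rw [LinearMap.comp_assoc, comul_inC, ← LinearMap.comp_assoc, LinearMap.lTensor_comp_map,
      counit_inC, counit_right_aux _ Coalgebra.lTensor_counit_comp_comul]
  · intro i
    rw [LinearMap.comp_assoc, comul_inA, ← LinearMap.comp_assoc, LinearMap.lTensor_comp_map,
      counit_inA, counit_right_aux _ Coalgebra.lTensor_counit_comp_comul]
  · intro i
    rw [LinearMap.comp_assoc, comul_inM, LinearMap.comp_add, ← LinearMap.comp_assoc,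
      ← LinearMap.comp_assoc, LinearMap.lTensor_comp_map, LinearMap.lTensor_comp_map,
      counit_inC, counit_inM, counit_right_aux _ RightComodule.counit_coact,
      TensorProduct.map_zero_right, LinearMap.zero_comp, zero_add]

/-- The coalgebra `C^~`. -/
instance : Coalgebra K (VeeTilde R) where
  comul := comul R
  counit := counit R
  coassoc := coassoc R
  rTensor_counit_comp_comul := counit_left R
  lTensor_counit_comp_comul := counit_right R

/-- `C` as a subcoalgebra of `C^~`. -/
def inCHom : C →ₗc[K] VeeTilde R :=
  { inC R with
    counit_comp := counit_inC R
    map_comp_comul := (comul_inC R).symm }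

/-- `A_M` as a subcoalgebra of `C^~`. -/
def inAHom (i : R.ι) : R.A i →ₗc[K] VeeTilde R :=
  { inA R i with
    counit_comp := counit_inA R i
    map_comp_comul := (comul_inA R i).symm }

end VeeTilde

/-! ### The coalgebra `C^∨` -/

/-- The subspace `I` of `C^~` spanned by the elements `g - g_M`, for `g` grouplike in `C` and
`g_M` grouplike in `A_M`. (If `C` is pointed colocal over an algebraically closed field, then `C`
and each `A_M` have exactly one grouplike element.) -/
def veeIdeal : Submodule K (VeeTilde R) :=
  Submodule.span K {z | ∃ (g : C) (i : R.ι) (a : R.A i), IsGroupLikeElem K g ∧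
    IsGroupLikeElem K a ∧ z = VeeTilde.inC R g - VeeTilde.inA R i a}

instance veeIdeal_isCoideal : (veeIdeal R).IsCoideal where
  counit_eq_zero := by
    intro x hx
    refine Submodule.span_induction (p := fun x _ => Coalgebra.counit (R := K) x = 0)
      ?_ (map_zero _) (fun x y _ _ h1 h2 => by rw [map_add, h1, h2, add_zero])
      (fun c x _ h => by rw [map_smul, h, smul_zero]) hx
    rintro _ ⟨g, i, a, hg, ha, rfl⟩
    have h1 := (hg.map (VeeTilde.inCHom R)).counit_eq_one
    have h2 := (ha.map (VeeTilde.inAHom R i)).counit_eq_one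
    change Coalgebra.counit (R := K) (VeeTilde.inC R g) = 1 at h1
    change Coalgebra.counit (R := K) (VeeTilde.inA R i a) = 1 at h2
    rw [map_sub, h1, h2, sub_self]
  map_mkQ_comul_eq_zero := by
    intro x hx
    refine Submodule.span_induction (p := fun x _ => TensorProduct.map (veeIdeal R).mkQ
      (veeIdeal R).mkQ (Coalgebra.comul (R := K) x) = 0)
      ?_ (by simp) (fun x y _ _ h1 h2 => by rw [map_add, map_add, h1, h2, add_zero])
      (fun c x _ h => by rw [map_smul, map_smul, h, smul_zero]) hx
    rintro _ ⟨g, i, a, hg, ha, rfl⟩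
    have h1 := (hg.map (VeeTilde.inCHom R)).comul_eq_tmul_self
    have h2 := (ha.map (VeeTilde.inAHom R i)).comul_eq_tmul_self
    change Coalgebra.comul (R := K) (VeeTilde.inC R g)
      = VeeTilde.inC R g ⊗ₜ VeeTilde.inC R g at h1
    change Coalgebra.comul (R := K) (VeeTilde.inA R i a)
      = VeeTilde.inA R i a ⊗ₜ VeeTilde.inA R i a at h2
    have h3 : (veeIdeal R).mkQ (VeeTilde.inC R g) = (veeIdeal R).mkQ (VeeTilde.inA R i a) :=
      (Submodule.Quotient.eq _).2 (Submodule.subset_span ⟨g, i, a, hg, ha, rfl⟩)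
    rw [map_sub, map_sub, h1, h2, TensorProduct.map_tmul, TensorProduct.map_tmul, h3, sub_self]

/-- The coalgebra `C^∨ = C^~ / I`. -/
abbrev Vee : Type u := VeeTilde R ⧸ veeIdeal R

/-- The canonical coalgebra morphism `C → C^~ → C^∨`. -/
def toVee : C →ₗc[K] Vee R :=
  (Coalgebra.Quotient.mkQCoalgHom (veeIdeal R)).comp (VeeTilde.inCHom R)

end Tilde

/-! ### The tower `C^[0] = C`, `C^[n+1] = (C^[n])^∨` and its union -/

section Tower

variable {K : Type u} [Field K] (R : ∀ D : CoalgCat.{u} K, IndecReps K D)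
  (C : Type u) [AddCommGroup C] [Module K C] [Coalgebra K C]

/-- The coalgebras `C^[n]`, for a choice `R` of representatives of the indecomposable finite
dimensional comodules over each coalgebra. -/
def tower : ℕ → CoalgCat.{u} K
  | 0 => CoalgCat.of K C
  | n + 1 => CoalgCat.of K (Vee (R (tower n)))

/-- The canonical coalgebra morphism `C^[n] → C^[n+1]`. -/
def towerStep (n : ℕ) : tower R C n →ₗc[K] tower R C (n + 1) :=
  toVee (R (tower R C n))

/-- The canonical coalgebra morphism `C^[m] → C^[n]` for `m ≤ n`. -/
def towerMap (m n : ℕ) (h : m ≤ n) : tower R C m →ₗc[K] tower R C n :=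
  Nat.leRec (motive := fun n _ => tower R C m →ₗc[K] tower R C n) (CoalgHom.id K _)
    (fun n _ f => (towerStep R C n).comp f) h

/-- The vector space `C_∞^∨`, the union (direct limit) of the `C^[n]`. -/
def VeeInf : Type u :=
  Module.DirectLimit (fun n => tower R C n) (fun m n h => (towerMap R C m n h).toLinearMap)

namespace VeeInf

instance : AddCommGroup (VeeInf R C) :=
  inferInstanceAs (AddCommGroup (Module.DirectLimit (fun n => tower R C n)
    (fun m n h => (towerMap R C m n h).toLinearMap)))

instance : Module K (VeeInf R C) :=
  inferInstanceAs (Module K (Module.DirectLimit (fun n => tower R C n)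
    (fun m n h => (towerMap R C m n h).toLinearMap)))

/-- The canonical map `C^[n] → C_∞^∨`. -/
def of (n : ℕ) : tower R C n →ₗ[K] VeeInf R C :=
  Module.DirectLimit.of K ℕ (fun n => tower R C n)
    (fun m n h => (towerMap R C m n h).toLinearMap) n

theorem of_towerMap {m n : ℕ} (h : m ≤ n) (x : tower R C m) :
    of R C n (towerMap R C m n h x) = of R C m x :=
  Module.DirectLimit.of_f (R := K) (ι := ℕ) (G := fun n => tower R C n)
    (f := fun m n h => (towerMap R C m n h).toLinearMap)

theorem of_comp_towerMap {m n : ℕ} (h : m ≤ n) :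
    of R C n ∘ₗ (towerMap R C m n h).toLinearMap = of R C m :=
  LinearMap.ext (of_towerMap R C h)

variable {R C} in
theorem hom_ext {P : Type u} [AddCommMonoid P] [Module K P] {f g : VeeInf R C →ₗ[K] P}
    (h : ∀ n, f ∘ₗ of R C n = g ∘ₗ of R C n) : f = g :=
  Module.DirectLimit.hom_ext (R := K) (ι := ℕ) (G := fun n => tower R C n)
    (f := fun m n h => (towerMap R C m n h).toLinearMap) h

theorem comul_compat (m n : ℕ) (h : m ≤ n) (x : tower R C m) :
    (TensorProduct.map (of R C n) (of R C n) ∘ₗ Coalgebra.comul)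
        ((towerMap R C m n h).toLinearMap x)
      = (TensorProduct.map (of R C m) (of R C m) ∘ₗ Coalgebra.comul) x := by
  have h1 : Coalgebra.comul (R := K) (towerMap R C m n h x)
      = TensorProduct.map (towerMap R C m n h).toLinearMap (towerMap R C m n h).toLinearMap
        (Coalgebra.comul (R := K) x) :=
    (LinearMap.congr_fun (towerMap R C m n h).map_comp_comul x).symm
  show TensorProduct.map (of R C n) (of R C n) (Coalgebra.comul (towerMap R C m n h x))
    = TensorProduct.map (of R C m) (of R C m) (Coalgebra.comul x)
  rw [h1, ← LinearMap.comp_apply, ← TensorProduct.map_comp, of_comp_towerMap]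

theorem counit_compat (m n : ℕ) (h : m ≤ n) (x : tower R C m) :
    Coalgebra.counit (R := K) ((towerMap R C m n h).toLinearMap x)
      = Coalgebra.counit (R := K) x :=
  LinearMap.congr_fun (towerMap R C m n h).counit_comp x

/-- The comultiplication of `C_∞^∨`, which is that of `C^[n]` on each `C^[n]`. -/
def comul : VeeInf R C →ₗ[K] VeeInf R C ⊗[K] VeeInf R C :=
  Module.DirectLimit.lift K ℕ (fun n => tower R C n)
    (fun m n h => (towerMap R C m n h).toLinearMap)
    (fun n => TensorProduct.map (of R C n) (of R C n) ∘ₗ Coalgebra.comul) (comul_compat R C)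

/-- The counit of `C_∞^∨`, which is that of `C^[n]` on each `C^[n]`. -/
def counit : VeeInf R C →ₗ[K] K :=
  Module.DirectLimit.lift K ℕ (fun n => tower R C n)
    (fun m n h => (towerMap R C m n h).toLinearMap)
    (fun _ => Coalgebra.counit) (counit_compat R C)

theorem comul_of (n : ℕ) :
    comul R C ∘ₗ of R C n = TensorProduct.map (of R C n) (of R C n) ∘ₗ Coalgebra.comul :=
  LinearMap.ext fun x => Module.DirectLimit.lift_of (R := K) (ι := ℕ) (G := fun n => tower R C n)
    (f := fun m n h => (towerMap R C m n h).toLinearMap)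
    (fun n => TensorProduct.map (of R C n) (of R C n) ∘ₗ Coalgebra.comul) (comul_compat R C) x

theorem counit_of (n : ℕ) : counit R C ∘ₗ of R C n = Coalgebra.counit :=
  LinearMap.ext fun x => Module.DirectLimit.lift_of (R := K) (ι := ℕ) (G := fun n => tower R C n)
    (f := fun m n h => (towerMap R C m n h).toLinearMap)
    (fun _ => Coalgebra.counit) (counit_compat R C) x

/-- The coalgebra `C_∞^∨`. -/
instance : Coalgebra K (VeeInf R C) where
  comul := comul R C
  counit := counit R C
  coassoc := by
    refine hom_ext fun n => ?_
    simp only [LinearMap.comp_assoc]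
    rw [comul_of, VeeTilde.expand_left, VeeTilde.expand_right, comul_of, VeeTilde.assoc_left,
      VeeTilde.assoc_right, Coalgebra.coassoc]
  rTensor_counit_comp_comul := by
    refine hom_ext fun n => ?_
    rw [LinearMap.comp_assoc, comul_of, ← LinearMap.comp_assoc, LinearMap.rTensor_comp_map,
      counit_of, VeeTilde.counit_left_aux _ Coalgebra.rTensor_counit_comp_comul]
  lTensor_counit_comp_comul := by
    refine hom_ext fun n => ?_
    rw [LinearMap.comp_assoc, comul_of, ← LinearMap.comp_assoc, LinearMap.lTensor_comp_map,
      counit_of, VeeTilde.counit_right_aux _ Coalgebra.lTensor_counit_comp_comul]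

end VeeInf

end Tower

end

end CoalgGen

/-!
The argument rests on three observations about one step `C → C^∨`, for a pointed colocal coalgebra
`C` with grouplike element `g`.

* *Indecomposables become quotients.* The projection of `C^~` onto a summand `M` is a morphism of
  right comodules, and it descends to `C^∨`. So every indecomposable finite dimensional
  `C`-comodule is a quotient of `C^∨`, by a morphism that vanishes on `C` (`Vee.exists_quotient`).
* *Morphisms extend by zero.* A comodule morphism on `C` that vanishes at `g` extends to `C^∨` by
  zero on the `A_M` and the `M` (`Vee.comp_retraction_eq`). This is composition with the retraction
  `C^∨ → C`, which exists because `C` has only one grouplike element; in particular `C → C^∨` is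
  injective.
* *`C^∨` is again pointed colocal* (`IsPointedColocal.vee`). A coalgebra is pointed colocal if and
  only if some grouplike element lies in all its nonzero subcoalgebras (`isPointedColocal_iff`,
  by local finiteness). If a nonzero subcoalgebra `D` of `C^∨` met `C` in `0`, there would be a
  functional `f` that vanishes on `C` and restricts to the counit on `D`. All convolution powers of
  `f` are then the counit on `D`. But `f` is locally nilpotent: it vanishes at the grouplike element
  of `A_M`, which is a character of the algebra `End(M)`, and by Fitting's lemma and the existence
  of eigenvalues the kernel of that character consists of nilpotent endomorphisms; on `m ∈ M` the
  claim follows from `δ(m) = m₍₋₁₎ ⊗ m₍₀₎ + m₀ ⊗ m₁`.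

Hence all `C^[n]`, and with them their union, are pointed colocal, and the `C^[n]` embed in the
union. A finite dimensional comodule `M` over the union has its coaction in some `M ⊗ C^[n]`. If `M`
is indecomposable, it is the image of a morphism on `C^[n+1]` which vanishes on `C^[n]`, hence at
the grouplike element, and this morphism extends by zero through all later stages
(`IsPointedColocal.exists_extension`). The generating condition follows, because comodules are
locally finite and finite dimensional ones are sums of indecomposables.

Subcomodules and subcoalgebras are handled throughout by contracting coactions and comultiplications
with functionals: a subspace is a subcomodule, or a subcoalgebra, if and only if it is stable under
all such contractions.
-/

namespace CoalgGen

open Module (Dual)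

/-! ### Contractions of tensors with functionals -/

section Contraction

variable {K V W V' W' : Type u} [Field K] [AddCommGroup V] [Module K V] [AddCommGroup W]
  [Module K W] [AddCommGroup V'] [Module K V'] [AddCommGroup W'] [Module K W']

/-- Contraction of the right-hand factor with a functional: `v ⊗ w ↦ f(w) v`. -/
noncomputable def contractRight (f : Dual K W) : V ⊗[K] W →ₗ[K] V :=
  (TensorProduct.rid K V).toLinearMap ∘ₗ f.lTensor V

/-- Contraction of the left-hand factor with a functional: `v ⊗ w ↦ f(v) w`. -/
noncomputable def contractLeft (f : Dual K V) : V ⊗[K] W →ₗ[K] W :=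
  (TensorProduct.lid K W).toLinearMap ∘ₗ f.rTensor W

@[simp]
theorem contractRight_tmul (f : Dual K W) (v : V) (w : W) :
    contractRight f (v ⊗ₜ[K] w) = f w • v := by
  simp [contractRight]

@[simp]
theorem contractLeft_tmul (f : Dual K V) (v : V) (w : W) :
    contractLeft f (v ⊗ₜ[K] w) = f v • w := by
  simp [contractLeft]

theorem contractRight_map (f : Dual K W') (a : V →ₗ[K] V') (b : W →ₗ[K] W') (t : V ⊗[K] W) :
    contractRight f (TensorProduct.map a b t) = a (contractRight (f ∘ₗ b) t) := by
  induction t with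
  | zero => simp
  | tmul v w => simp
  | add s t hs ht => simp only [map_add, hs, ht]

theorem contractLeft_map (f : Dual K V') (a : V →ₗ[K] V') (b : W →ₗ[K] W') (t : V ⊗[K] W) :
    contractLeft f (TensorProduct.map a b t) = b (contractLeft (f ∘ₗ a) t) := by
  induction t with
  | zero => simp
  | tmul v w => simp
  | add s t hs ht => simp only [map_add, hs, ht]

theorem contractRight_rTensor (f : Dual K W) (a : V →ₗ[K] V') (t : V ⊗[K] W) :
    contractRight f (a.rTensor W t) = a (contractRight f t) :=
  contractRight_map f a LinearMap.id t

theorem contractRight_comm (f : Dual K W) (t : W ⊗[K] V) :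
    contractRight f (TensorProduct.comm K W V t) = contractLeft f t := by
  induction t with
  | zero => simp
  | tmul v w => simp
  | add s t hs ht => simp only [map_add, hs, ht]

/-- A tensor is determined by its contractions, because they give its coordinates with respect to
a basis of one factor. -/
theorem eq_zero_of_contractRight {t : V ⊗[K] W} (h : ∀ f : Dual K W, contractRight f t = 0) :
    t = 0 := by
  classical
  let b := Module.Basis.ofVectorSpace K W
  apply (TensorProduct.equivFinsuppOfBasisRight (M := V) b).injective
  rw [map_zero]
  ext i
  rw [Finsupp.zero_apply, ← h (b.coord i)]
  generalize t = t
  induction t with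
  | zero => simp
  | tmul v w => simp
  | add s t hs ht => simp only [map_add, Finsupp.add_apply, hs, ht]

theorem mem_range_rTensor_iff {P : Submodule K V} {t : V ⊗[K] W} :
    t ∈ LinearMap.range (P.subtype.rTensor W) ↔ ∀ f : Dual K W, contractRight f t ∈ P := by
  constructor
  · rintro ⟨s, rfl⟩ f
    rw [contractRight_rTensor]
    exact Subtype.coe_prop _
  · intro h
    have hex : Function.Exact (P.subtype.rTensor W) (P.mkQ.rTensor W) :=
      rTensor_exact W (LinearMap.exact_subtype_mkQ P) (Submodule.mkQ_surjective P)
    rw [← LinearMap.exact_iff.1 hex, LinearMap.mem_ker]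
    apply eq_zero_of_contractRight
    intro f
    rw [contractRight_rTensor, Submodule.mkQ_apply, Submodule.Quotient.mk_eq_zero]
    exact h f

theorem mem_range_lTensor_iff {Q : Submodule K W} {t : V ⊗[K] W} :
    t ∈ LinearMap.range (Q.subtype.lTensor V) ↔ ∀ f : Dual K V, contractLeft f t ∈ Q := by
  have h1 : t ∈ LinearMap.range (Q.subtype.lTensor V) ↔
      TensorProduct.comm K V W t ∈ LinearMap.range (Q.subtype.rTensor V) := by
    rw [← LinearMap.comm_comp_rTensor_comp_comm_eq]
    constructor
    · rintro ⟨s, rfl⟩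
      exact ⟨TensorProduct.comm K V Q s, by simp⟩
    · rintro ⟨s, hs⟩
      refine ⟨TensorProduct.comm K Q V s, ?_⟩
      apply (TensorProduct.comm K V W).injective
      simp [← hs]
  rw [h1, mem_range_rTensor_iff]
  simp only [contractRight_comm]

/-- A tensor lies in `P ⊗ Q` as soon as its contractions lie in `P` and in `Q`. -/
theorem mem_range_map_of_contract {P : Submodule K V} {Q : Submodule K W} {t : V ⊗[K] W}
    (hP : ∀ f : Dual K W, contractRight f t ∈ P) (hQ : ∀ f : Dual K V, contractLeft f t ∈ Q) :
    t ∈ LinearMap.range (TensorProduct.map P.subtype Q.subtype) := by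
  obtain ⟨s, rfl⟩ := mem_range_rTensor_iff.2 hP
  have h1 : s ∈ LinearMap.range (Q.subtype.lTensor P) := by
    rw [mem_range_lTensor_iff]
    intro f
    obtain ⟨f', rfl⟩ := LinearMap.exists_extend (p := P) f
    have := hQ f'
    rwa [LinearMap.rTensor, contractLeft_map] at this
  obtain ⟨r, rfl⟩ := h1
  refine ⟨r, ?_⟩
  rw [← LinearMap.comp_apply, LinearMap.rTensor_comp_lTensor]

theorem contractRight_mem_range_map {P : Submodule K V} {Q : Submodule K W} {t : V ⊗[K] W}
    (h : t ∈ LinearMap.range (TensorProduct.map P.subtype Q.subtype)) (f : Dual K W) :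
    contractRight f t ∈ P := by
  obtain ⟨s, rfl⟩ := h
  rw [contractRight_map]
  exact Subtype.coe_prop _

theorem contractLeft_mem_range_map {P : Submodule K V} {Q : Submodule K W} {t : V ⊗[K] W}
    (h : t ∈ LinearMap.range (TensorProduct.map P.subtype Q.subtype)) (f : Dual K V) :
    contractLeft f t ∈ Q := by
  obtain ⟨s, rfl⟩ := h
  rw [contractLeft_map]
  exact Subtype.coe_prop _

/-- The contractions of a given tensor span a finite dimensional space. -/
theorem exists_fg_contractRight (t : V ⊗[K] W) :
    ∃ P : Submodule K V, P.FG ∧ ∀ f : Dual K W, contractRight f t ∈ P := by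
  induction t with
  | zero => exact ⟨⊥, Submodule.fg_bot, by simp⟩
  | tmul v w =>
    refine ⟨K ∙ v, Submodule.fg_span_singleton v, fun f => ?_⟩
    rw [contractRight_tmul]
    exact Submodule.smul_mem _ _ (Submodule.mem_span_singleton_self v)
  | add s t hs ht =>
    obtain ⟨P, hP, hP'⟩ := hs
    obtain ⟨Q, hQ, hQ'⟩ := ht
    refine ⟨P ⊔ Q, hP.sup hQ, fun f => ?_⟩
    rw [map_add]
    exact Submodule.add_mem_sup (hP' f) (hQ' f)

theorem exists_fg_contractLeft (t : V ⊗[K] W) :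
    ∃ Q : Submodule K W, Q.FG ∧ ∀ f : Dual K V, contractLeft f t ∈ Q := by
  obtain ⟨Q, hQ, hQ'⟩ := exists_fg_contractRight (TensorProduct.comm K V W t)
  exact ⟨Q, hQ, fun f => contractRight_comm f t ▸ hQ' f⟩

end Contraction

/-! ### Local finiteness of comodules -/

section LocallyFinite

variable {K C M : Type u} [Field K] [AddCommGroup C] [Module K C] [Coalgebra K C]
  [AddCommGroup M] [Module K M] [RightComodule K C M]

theorem isSubcomodule_iff {P : Submodule K M} :
    IsSubcomodule C P ↔ ∀ x ∈ P, ∀ f : Dual K C, contractRight f (coact K C M x) ∈ P :=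
  forall₂_congr fun _ _ => mem_range_rTensor_iff

theorem contractRight_counit_coact (x : M) :
    contractRight Coalgebra.counit (coact K C M x) = x := by
  have h := LinearMap.congr_fun (RightComodule.counit_coact (K := K) (C := C) (M := M)) x
  rw [LinearMap.comp_apply] at h
  rw [contractRight, LinearMap.comp_apply, h]
  simp

/-- The functionals on `C` act on a comodule through the convolution product. -/
theorem contractRight_coact_contractRight (f h : Dual K C) (x : M) :
    contractRight f (coact K C M (contractRight h (coact K C M x)))
      = contractRight (LinearMap.mul' K K ∘ₗ TensorProduct.map f h ∘ₗ Coalgebra.comul)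
        (coact K C M x) := by
  have h1 : ∀ t : M ⊗[K] C, contractRight f (coact K C M (contractRight h t))
      = contractRight (LinearMap.mul' K K ∘ₗ TensorProduct.map f h)
        (TensorProduct.assoc K M C C ((coact K C M).rTensor C t)) := by
    intro t
    induction t with
    | zero => simp
    | tmul m c =>
      rw [contractRight_tmul, map_smul, map_smul, LinearMap.rTensor_tmul]
      generalize coact K C M m = s
      induction s with
      | zero => simp
      | tmul m' c' => simp [smul_smul, mul_comm]
      | add s t hs ht => simp only [map_add, TensorProduct.add_tmul, smul_add, hs, ht]
    | add s t hs ht => simp only [map_add, hs, ht]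
  have h2 := LinearMap.congr_fun (RightComodule.coassoc (K := K) (C := C) (M := M)) x
  simp only [LinearMap.comp_apply, LinearEquiv.coe_coe] at h2
  rw [h1, h2, LinearMap.lTensor, contractRight_map]
  rfl

/-- Every element of a comodule lies in a finite dimensional subcomodule: the space of its
translates under the functionals on `C`. -/
theorem exists_finite_subcomodule (x : M) :
    ∃ P : Submodule K M, P.FG ∧ IsSubcomodule C P ∧ x ∈ P := by
  let S : Submodule K M := Submodule.span K
    (Set.range fun f : Dual K C => contractRight f (coact K C M x))
  obtain ⟨Q, hQ, hQ'⟩ := exists_fg_contractRight (coact K C M x)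
  have hSQ : S ≤ Q := Submodule.span_le.2 (by rintro _ ⟨f, rfl⟩; exact hQ' f)
  have : Module.Finite K Q := Module.Finite.iff_fg.2 hQ
  refine ⟨S, ?_, isSubcomodule_iff.2 fun y hy f => ?_, ?_⟩
  · have := Submodule.finiteDimensional_of_le hSQ
    exact Module.Finite.iff_fg.1 this
  · induction hy using Submodule.span_induction with
    | mem y hy =>
      obtain ⟨h, rfl⟩ := hy
      dsimp only
      rw [contractRight_coact_contractRight]
      exact Submodule.subset_span ⟨_, rfl⟩
    | zero => simp
    | add y z _ _ hy hz => simpa only [map_add] using add_mem hy hz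
    | smul c y _ hy => simpa only [map_smul] using Submodule.smul_mem _ c hy
  · exact Submodule.subset_span ⟨_, contractRight_counit_coact x⟩

/-- A coaction on `V` which is compatible with a comodule `M` along injections `V → M` and
`D → C`, the latter a coalgebra morphism, satisfies the comodule axioms. -/
abbrev comoduleOfInjective {V D : Type u} [AddCommGroup V] [Module K V] [AddCommGroup D]
    [Module K D] [Coalgebra K D] (f : V →ₗ[K] M) (j : D →ₗc[K] C) (hf : Function.Injective f)
    (hj : Function.Injective j) (ρ : V →ₗ[K] V ⊗[K] D)
    (hρ : TensorProduct.map f j.toLinearMap ∘ₗ ρ = coact K C M ∘ₗ f) : RightComodule K D V where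
  coact := ρ
  coassoc := by
    have hinj : Function.Injective
        (TensorProduct.map f (TensorProduct.map j.toLinearMap j.toLinearMap)) :=
      TensorProduct.map_injective_of_flat_flat _ _ hf
        (TensorProduct.map_injective_of_flat_flat _ _ hj hj)
    rw [← LinearMap.cancel_left hinj]
    have h1 : TensorProduct.map f (TensorProduct.map j.toLinearMap j.toLinearMap)
          ∘ₗ (TensorProduct.assoc K V D D).toLinearMap ∘ₗ ρ.rTensor D
        = (TensorProduct.assoc K M C C).toLinearMap ∘ₗ (coact K C M).rTensor C
          ∘ₗ TensorProduct.map f j.toLinearMap := by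
      rw [LinearMap.rTensor_comp_map, ← hρ]
      ext v d
      simp only [LinearMap.comp_apply, TensorProduct.AlgebraTensorModule.curry_apply,
        LinearMap.restrictScalars_self, TensorProduct.curry_apply, LinearMap.rTensor_tmul,
        TensorProduct.map_tmul, LinearEquiv.coe_coe]
      generalize ρ v = t
      induction t with
      | zero => simp
      | tmul x y => simp
      | add s t hs ht => simp only [map_add, TensorProduct.add_tmul, hs, ht]
    have h2 : TensorProduct.map f (TensorProduct.map j.toLinearMap j.toLinearMap)
          ∘ₗ (Coalgebra.comul (R := K) (A := D)).lTensor V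
        = (Coalgebra.comul (R := K) (A := C)).lTensor M ∘ₗ TensorProduct.map f j.toLinearMap := by
      rw [LinearMap.lTensor_comp_map, LinearMap.map_comp_lTensor]
      exact congrArg (TensorProduct.map f) j.map_comp_comul
    calc _ = (TensorProduct.map f (TensorProduct.map j.toLinearMap j.toLinearMap)
          ∘ₗ (TensorProduct.assoc K V D D).toLinearMap ∘ₗ ρ.rTensor D) ∘ₗ ρ := rfl
      _ = ((TensorProduct.assoc K M C C).toLinearMap ∘ₗ (coact K C M).rTensor C ∘ₗ coact K C M)
          ∘ₗ f := by
        rw [h1, LinearMap.comp_assoc, LinearMap.comp_assoc, hρ]; rfl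
      _ = (Coalgebra.comul (R := K) (A := C)).lTensor M ∘ₗ TensorProduct.map f j.toLinearMap
          ∘ₗ ρ := by
        rw [RightComodule.coassoc, hρ]; rfl
      _ = _ := by rw [← LinearMap.comp_assoc, ← h2]; rfl
  counit_coact := by
    have hinj : Function.Injective (f.rTensor K) :=
      Module.Flat.rTensor_preserves_injective_linearMap _ hf
    rw [← LinearMap.cancel_left hinj]
    have h2 : f.rTensor K ∘ₗ (Coalgebra.counit (R := K) (A := D)).lTensor V
        = (Coalgebra.counit (R := K) (A := C)).lTensor M ∘ₗ TensorProduct.map f j.toLinearMap := by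
      rw [LinearMap.lTensor_comp_map, LinearMap.rTensor_comp_lTensor]
      exact congrArg (TensorProduct.map f) j.counit_comp.symm
    rw [← LinearMap.comp_assoc, h2, LinearMap.comp_assoc, hρ, ← LinearMap.comp_assoc,
      RightComodule.counit_coact]
    ext x; simp

theorem IsSubcomodule.exists_coact {P : Submodule K M} (hP : IsSubcomodule C P) :
    ∃ ρ : P →ₗ[K] P ⊗[K] C, P.subtype.rTensor C ∘ₗ ρ = coact K C M ∘ₗ P.subtype := by
  have hinj : Function.Injective (P.subtype.rTensor C) :=
    Module.Flat.rTensor_preserves_injective_linearMap _ P.injective_subtype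
  refine ⟨(LinearEquiv.ofInjective _ hinj).symm.toLinearMap ∘ₗ
    (coact K C M ∘ₗ P.subtype).codRestrict _ fun x => hP x x.2, ?_⟩
  ext x
  exact congrArg Subtype.val ((LinearEquiv.ofInjective _ hinj).apply_symm_apply _)

/-- A subcomodule as a comodule. -/
noncomputable abbrev IsSubcomodule.comodule {P : Submodule K M} (hP : IsSubcomodule C P) :
    RightComodule K C P :=
  comoduleOfInjective P.subtype (CoalgHom.id K C) P.injective_subtype Function.injective_id
    hP.exists_coact.choose hP.exists_coact.choose_spec

theorem IsSubcomodule.isComoduleHom_subtype {P : Submodule K M} (hP : IsSubcomodule C P) :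
    letI := hP.comodule
    IsComoduleHom C P.subtype :=
  hP.exists_coact.choose_spec.symm

end LocallyFinite

/-! ### Subcoalgebras -/

section Subcoalgebra

variable {K C : Type u} [Field K] [AddCommGroup C] [Module K C] [Coalgebra K C]

theorem isSubcoalgebra_iff {D : Submodule K C} :
    IsSubcoalgebra K D ↔ ∀ x ∈ D, ∀ f : Dual K C,
      contractRight f (Coalgebra.comul (R := K) x) ∈ D ∧
      contractLeft f (Coalgebra.comul (R := K) x) ∈ D :=
  ⟨fun h x hx f => ⟨contractRight_mem_range_map (h x hx) f, contractLeft_mem_range_map (h x hx) f⟩,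
    fun h x hx => mem_range_map_of_contract (fun f => (h x hx f).1) fun f => (h x hx f).2⟩

/-- The preimage of a subcoalgebra under an injective morphism is a subcoalgebra. -/
theorem IsSubcoalgebra.comap {C' : Type u} [AddCommGroup C'] [Module K C'] [Coalgebra K C']
    {D : Submodule K C'} (hD : IsSubcoalgebra K D) (φ : C →ₗc[K] C')
    (hφ : Function.Injective φ) : IsSubcoalgebra K (D.comap φ.toLinearMap) := by
  rw [isSubcoalgebra_iff] at *
  intro x hx f
  obtain ⟨r, hr⟩ := φ.toLinearMap.exists_leftInverse_of_injective (LinearMap.ker_eq_bot.2 hφ)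
  have h1 : Coalgebra.comul (R := K) (φ.toLinearMap x)
      = TensorProduct.map φ.toLinearMap φ.toLinearMap (Coalgebra.comul (R := K) x) :=
    (LinearMap.congr_fun φ.map_comp_comul x).symm
  have h2 := hD _ hx (f ∘ₗ r)
  rw [h1, contractRight_map, contractLeft_map, LinearMap.comp_assoc, hr, LinearMap.comp_id] at h2
  exact h2

theorem contractLeft_counit_comul (x : C) :
    contractLeft Coalgebra.counit (Coalgebra.comul (R := K) x) = x := by
  have h := LinearMap.congr_fun (Coalgebra.rTensor_counit_comp_comul (R := K) (A := C)) x
  rw [LinearMap.comp_apply] at h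
  rw [contractLeft, LinearMap.comp_apply, h]
  simp

theorem contractRight_comul_contractLeft (f h : Dual K C) (x : C) :
    contractRight f (Coalgebra.comul (R := K) (contractLeft h (Coalgebra.comul (R := K) x)))
      = contractLeft h (Coalgebra.comul (R := K)
        (contractRight f (Coalgebra.comul (R := K) x))) := by
  have h1 : ∀ t : C ⊗[K] C, contractRight f (Coalgebra.comul (R := K) (contractLeft h t))
      = contractLeft h ((contractRight f).lTensor C ((Coalgebra.comul (R := K)).lTensor C t)) := by
    intro t
    induction t with
    | zero => simp
    | tmul a b => simp
    | add s t hs ht => simp only [map_add, hs, ht]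
  have h2 : ∀ t : C ⊗[K] C, contractLeft h (Coalgebra.comul (R := K) (contractRight f t))
      = contractLeft h ((contractRight f).lTensor C
        (TensorProduct.assoc K C C C ((Coalgebra.comul (R := K)).rTensor C t))) := by
    intro t
    induction t with
    | zero => simp
    | tmul a b =>
      rw [contractRight_tmul, map_smul, map_smul, LinearMap.rTensor_tmul]
      generalize Coalgebra.comul (R := K) a = s
      induction s with
      | zero => simp
      | tmul c d => simp [smul_smul]
      | add s t hs ht => simp only [map_add, TensorProduct.add_tmul, smul_add, hs, ht]
    | add s t hs ht => simp only [map_add, hs, ht]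
  rw [h1, h2, Coalgebra.coassoc_apply]

theorem contractLeft_comul_contractLeft (f h : Dual K C) (x : C) :
    contractLeft f (Coalgebra.comul (R := K) (contractLeft h (Coalgebra.comul (R := K) x)))
      = contractLeft (LinearMap.mul' K K ∘ₗ TensorProduct.map h f ∘ₗ Coalgebra.comul)
        (Coalgebra.comul (R := K) x) := by
  have h1 : ∀ t : C ⊗[K] C, contractLeft f (Coalgebra.comul (R := K) (contractLeft h t))
      = contractLeft h ((contractLeft f).lTensor C ((Coalgebra.comul (R := K)).lTensor C t)) := by
    intro t
    induction t with
    | zero => simp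
    | tmul a b => simp
    | add s t hs ht => simp only [map_add, hs, ht]
  have h2 : ∀ t : C ⊗[K] C,
      contractLeft (LinearMap.mul' K K ∘ₗ TensorProduct.map h f ∘ₗ Coalgebra.comul) t
      = contractLeft h ((contractLeft f).lTensor C
        (TensorProduct.assoc K C C C ((Coalgebra.comul (R := K)).rTensor C t))) := by
    intro t
    induction t with
    | zero => simp
    | tmul a b =>
      rw [contractLeft_tmul, LinearMap.rTensor_tmul, LinearMap.comp_apply, LinearMap.comp_apply]
      generalize Coalgebra.comul (R := K) a = s
      induction s with
      | zero => simp
      | tmul c d => simp [smul_smul, mul_comm]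
      | add s t hs ht => simp only [map_add, TensorProduct.add_tmul, add_smul, hs, ht]
    | add s t hs ht => simp only [map_add, hs, ht]
  rw [h1, h2, Coalgebra.coassoc_apply]

theorem exists_fg_leftTranslates {P : Submodule K C} (hP : P.FG) :
    ∃ Q : Submodule K C, Q.FG ∧ ∀ z ∈ P, ∀ h : Dual K C,
      contractLeft h (Coalgebra.comul (R := K) z) ∈ Q := by
  induction P, hP using Submodule.fg_induction with
  | singleton z =>
    obtain ⟨Q, hQ, hQ'⟩ := exists_fg_contractLeft (Coalgebra.comul (R := K) z)
    refine ⟨Q, hQ, fun y hy h => ?_⟩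
    obtain ⟨c, rfl⟩ := Submodule.mem_span_singleton.1 hy
    rw [map_smul, map_smul]
    exact Q.smul_mem c (hQ' h)
  | sup P₁ P₂ _ _ h₁ h₂ =>
    obtain ⟨Q₁, hQ₁, hQ₁'⟩ := h₁
    obtain ⟨Q₂, hQ₂, hQ₂'⟩ := h₂
    refine ⟨Q₁ ⊔ Q₂, hQ₁.sup hQ₂, fun y hy h => ?_⟩
    obtain ⟨y₁, hy₁, y₂, hy₂, rfl⟩ := Submodule.mem_sup.1 hy
    rw [map_add, map_add]
    exact Submodule.add_mem_sup (hQ₁' _ hy₁ h) (hQ₂' _ hy₂ h)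

/-- Every element of a coalgebra lies in a finite dimensional subcoalgebra, which may be taken
inside any given subcoalgebra that contains the element. -/
theorem exists_finite_subcoalgebra {D : Submodule K C} (hD : IsSubcoalgebra K D) {x : C}
    (hx : x ∈ D) : ∃ D' : Submodule K C, D'.FG ∧ IsSubcoalgebra K D' ∧ x ∈ D' ∧ D' ≤ D := by
  obtain ⟨P, hP, hPc, hxP⟩ := exists_finite_subcomodule (K := K) (C := C) (M := C) x
  rw [isSubcomodule_iff] at hPc
  rw [isSubcoalgebra_iff] at hD
  let P' := P ⊓ D
  have hP' : P'.FG := by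
    have : Module.Finite K P := Module.Finite.iff_fg.2 hP
    exact Module.Finite.iff_fg.1 (Submodule.finiteDimensional_of_le (inf_le_left : P' ≤ P))
  -- the left translates of a finite dimensional right subcomodule form a subcoalgebra
  let S : Submodule K C := Submodule.span K
    {y | ∃ z ∈ P', ∃ h : Dual K C, y = contractLeft h (Coalgebra.comul (R := K) z)}
  have hS : S.FG := by
    obtain ⟨Q, hQ, hQ'⟩ := exists_fg_leftTranslates hP'
    have : Module.Finite K Q := Module.Finite.iff_fg.2 hQ
    have hSQ : S ≤ Q := Submodule.span_le.2 (by rintro _ ⟨z, hz, h, rfl⟩; exact hQ' z hz h)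
    exact Module.Finite.iff_fg.1 (Submodule.finiteDimensional_of_le hSQ)
  refine ⟨S, hS, ?_, Submodule.subset_span
    ⟨x, ⟨hxP, hx⟩, Coalgebra.counit, (contractLeft_counit_comul x).symm⟩, ?_⟩
  · rw [isSubcoalgebra_iff]
    intro y hy f
    induction hy using Submodule.span_induction with
    | mem y hy =>
      obtain ⟨z, hz, h, rfl⟩ := hy
      rw [contractRight_comul_contractLeft, contractLeft_comul_contractLeft]
      exact ⟨Submodule.subset_span ⟨_, ⟨hPc z hz.1 f, (hD z hz.2 f).1⟩, h, rfl⟩,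
        Submodule.subset_span ⟨z, hz, _, rfl⟩⟩
    | zero => simp
    | add y z _ _ hy hz => simpa only [map_add] using ⟨add_mem hy.1 hz.1, add_mem hy.2 hz.2⟩
    | smul c y _ hy =>
      simpa only [map_smul] using ⟨Submodule.smul_mem _ c hy.1, Submodule.smul_mem _ c hy.2⟩
  · refine Submodule.span_le.2 ?_
    rintro _ ⟨z, hz, h, rfl⟩
    exact (hD z hz.2 h).2

/-- Every nonzero subcoalgebra contains a simple one. -/
theorem exists_simple_subcoalgebra {D : Submodule K C} (hD : IsSubcoalgebra K D) (h0 : D ≠ ⊥) :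
    ∃ S ≤ D, IsSimpleSubcoalgebra K S := by
  obtain ⟨x, hx, hx0⟩ := D.ne_bot_iff.1 h0
  obtain ⟨D₁, hfg, hD₁, hx₁, hle⟩ := exists_finite_subcoalgebra hD hx
  let p : ℕ → Prop := fun n => ∃ S : Submodule K C, S ≤ D₁ ∧ IsSubcoalgebra K S ∧ S ≠ ⊥ ∧
    Module.finrank K S = n
  have hp : ∃ n, p n := ⟨_, D₁, le_rfl, hD₁, fun h => hx0 (by rwa [h] at hx₁), rfl⟩
  classical
  obtain ⟨S, hS, hSc, hS0, hSn⟩ := Nat.find_spec hp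
  refine ⟨S, hS.trans hle, hSc, hS0, fun S' hS' hle' => ?_⟩
  by_cases h : S' = ⊥
  · exact Or.inl h
  right
  have : Module.Finite K D₁ := Module.Finite.iff_fg.2 hfg
  have : Module.Finite K S := Submodule.finiteDimensional_of_le hS
  refine Submodule.eq_of_le_of_finrank_le hle' ?_
  rw [hSn]
  exact Nat.find_min' hp ⟨S', hle'.trans hS, hS', h, rfl⟩

theorem isSubcoalgebra_span_of_isGroupLikeElem {g : C} (hg : IsGroupLikeElem K g) :
    IsSubcoalgebra K (K ∙ g) := by
  rw [isSubcoalgebra_iff]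
  intro x hx f
  obtain ⟨c, rfl⟩ := Submodule.mem_span_singleton.1 hx
  rw [map_smul, hg.comul_eq_tmul_self, map_smul, map_smul, contractRight_tmul, contractLeft_tmul,
    smul_smul]
  exact ⟨Submodule.smul_mem _ _ (Submodule.mem_span_singleton_self g),
    Submodule.smul_mem _ _ (Submodule.mem_span_singleton_self g)⟩

theorem isSimpleSubcoalgebra_span_of_isGroupLikeElem {g : C} (hg : IsGroupLikeElem K g) :
    IsSimpleSubcoalgebra K (K ∙ g) := by
  refine ⟨isSubcoalgebra_span_of_isGroupLikeElem hg, ?_, fun D _ hle => ?_⟩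
  · rw [ne_eq, Submodule.span_singleton_eq_bot]
    exact hg.ne_zero
  · exact (nonzero_span_atom g hg.ne_zero).le_iff.1 hle

/-- A coalgebra is pointed colocal if and only if some grouplike element is contained in all
nonzero subcoalgebras. -/
theorem isPointedColocal_iff :
    IsPointedColocal K C ↔ ∃ g : C, IsGroupLikeElem K g ∧
      ∀ D : Submodule K C, IsSubcoalgebra K D → D ≠ ⊥ → g ∈ D := by
  constructor
  · rintro ⟨g, hg, hcor⟩
    refine ⟨g, hg, fun D hD h0 => ?_⟩
    obtain ⟨S, hSD, hS⟩ := exists_simple_subcoalgebra hD h0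
    have hle : S ≤ K ∙ g := hcor ▸ le_sSup (a := S) hS
    rcases (nonzero_span_atom g hg.ne_zero).le_iff.1 hle with h | h
    · exact absurd h hS.2.1
    · exact hSD (h ▸ Submodule.mem_span_singleton_self g)
  · rintro ⟨g, hg, h⟩
    refine ⟨g, hg, le_antisymm (sSup_le fun S hS => ?_)
      (le_sSup (isSimpleSubcoalgebra_span_of_isGroupLikeElem hg))⟩
    have hgS : K ∙ g ≤ S := (Submodule.span_singleton_le_iff_mem _ _).2 (h S hS.1 hS.2.1)
    rcases hS.2.2 _ (isSubcoalgebra_span_of_isGroupLikeElem hg) hgS with h' | h'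
    · exact absurd ((Submodule.span_singleton_eq_bot).1 h') hg.ne_zero
    · exact h'.ge

theorem IsPointedColocal.isColocal (h : IsPointedColocal K C) : IsColocal K C := by
  obtain ⟨g, hg, hcor⟩ := h
  rw [IsColocal, hcor]
  exact isSimpleSubcoalgebra_span_of_isGroupLikeElem hg

/-- A pointed colocal coalgebra has only one grouplike element. -/
theorem IsPointedColocal.eq_of_isGroupLikeElem (h : IsPointedColocal K C) {g g' : C}
    (hg : IsGroupLikeElem K g) (hg' : IsGroupLikeElem K g') : g = g' := by
  obtain ⟨g₀, hg₀, h⟩ := isPointedColocal_iff.1 h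
  have key : ∀ g₁ : C, IsGroupLikeElem K g₁ → g₀ = g₁ := fun g₁ h₁ => by
    obtain ⟨c, hc⟩ := Submodule.mem_span_singleton.1 (h _
      (isSubcoalgebra_span_of_isGroupLikeElem h₁)
      (isSimpleSubcoalgebra_span_of_isGroupLikeElem h₁).2.1)
    have := congrArg (Coalgebra.counit (R := K)) hc
    rw [map_smul, h₁.counit_eq_one, hg₀.counit_eq_one, smul_eq_mul, mul_one] at this
    rw [← hc, this, one_smul]
  rw [← key g hg, ← key g' hg']

end Subcoalgebra

/-! ### Convolution powers of functionals -/

section Convolution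

variable {K C : Type u} [Field K] [AddCommGroup C] [Module K C] [Coalgebra K C]

/-- The powers of a functional in the convolution algebra `C^*`. -/
noncomputable def convPow (f : Dual K C) : ℕ → Dual K C
  | 0 => Coalgebra.counit
  | n + 1 => LinearMap.mul' K K ∘ₗ TensorProduct.map (convPow f n) f ∘ₗ Coalgebra.comul

theorem convPow_succ_apply (f : Dual K C) (n : ℕ) (x : C) : convPow f (n + 1) x
    = LinearMap.mul' K K (TensorProduct.map (convPow f n) f (Coalgebra.comul (R := K) x)) := rfl

theorem convPow_comp {C' : Type u} [AddCommGroup C'] [Module K C'] [Coalgebra K C']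
    (φ : C →ₗc[K] C') (f : Dual K C') (n : ℕ) :
    convPow f n ∘ₗ φ.toLinearMap = convPow (f ∘ₗ φ.toLinearMap) n := by
  induction n with
  | zero => exact φ.counit_comp
  | succ n ih =>
    have h := φ.map_comp_comul
    rw [convPow, convPow, ← ih, TensorProduct.map_comp, LinearMap.comp_assoc, LinearMap.comp_assoc,
      LinearMap.comp_assoc, h]

/-- If a functional restricts to the counit of a subcoalgebra, then so do its convolution
powers. -/
theorem convPow_eq_counit {D : Submodule K C} (hD : IsSubcoalgebra K D) {f : Dual K C}
    (hf : ∀ x ∈ D, f x = Coalgebra.counit (R := K) x) (n : ℕ) {x : C} (hx : x ∈ D) :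
    convPow f n x = Coalgebra.counit (R := K) x := by
  induction n generalizing x with
  | zero => rfl
  | succ n ih =>
    have h1 : ∀ t ∈ LinearMap.range (TensorProduct.map D.subtype D.subtype),
        LinearMap.mul' K K (TensorProduct.map (convPow f n) f t)
          = Coalgebra.counit (R := K) (contractRight Coalgebra.counit t) := by
      rintro _ ⟨s, rfl⟩
      induction s with
      | zero => simp
      | tmul a b => simp [ih a.2, hf b b.2, mul_comm]
      | add s t hs ht => simp only [map_add, hs, ht]
    rw [convPow_succ_apply, h1 _ (hD x hx)]
    exact congrArg _ (contractRight_counit_coact (K := K) (C := C) (M := C) x)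

end Convolution

/-! ### The coalgebra dual to a local algebra -/

section LocalAlgebra

variable {K E : Type u} [Field K] [Ring E] [Algebra K E]

theorem not_isNilpotent_of_mul_eq_one [Nontrivial E] {x y : E} (h : x * y = 1) :
    ¬ IsNilpotent x ∧ ¬ IsNilpotent y := by
  constructor
  · rintro ⟨n, hn⟩
    have := pow_mul_pow_eq_one n h
    rw [hn, zero_mul] at this
    exact zero_ne_one this
  · rintro ⟨n, hn⟩
    have := pow_mul_pow_eq_one n h
    rw [hn, mul_zero] at this
    exact zero_ne_one this

/-- If every element of `E` is the sum of a scalar and a nilpotent element, then the nilpotent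
elements are the kernel of a character of `E`. -/
theorem exists_algHom_isNilpotent [Nontrivial E]
    (h : ∀ e : E, ∃ c : K, IsNilpotent (e - algebraMap K E c)) :
    ∃ χ : E →ₐ[K] K, ∀ e, χ e = 0 → IsNilpotent e := by
  have hunit : ∀ e : E, ¬ IsNilpotent e → IsUnit e := by
    intro e he
    obtain ⟨c, hc⟩ := h e
    have hc0 : c ≠ 0 := by
      rintro rfl
      exact he (by simpa using hc)
    have h1 : IsUnit (algebraMap K E c) := (IsUnit.mk0 c hc0).map (algebraMap K E)
    have h2 := hc.isUnit_add_left_of_commute h1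
      (Algebra.commutes c _).symm
    simpa using h2
  have hmul : ∀ x y : E, IsNilpotent x → IsNilpotent (x * y) := by
    intro x y hx
    by_contra hxy
    obtain ⟨u, hu⟩ := hunit _ hxy
    have : x * (y * ↑u⁻¹) = 1 := by rw [← mul_assoc, ← hu, Units.mul_inv]
    exact (not_isNilpotent_of_mul_eq_one this).1 hx
  have hadd : ∀ x y : E, IsNilpotent x → IsNilpotent y → IsNilpotent (x + y) := by
    intro x y hx hy
    by_contra hxy
    obtain ⟨u, hu⟩ := hunit _ hxy
    have h1 : IsUnit (1 - x * ↑u⁻¹) := (hmul x _ hx).isUnit_one_sub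
    have h2 : 1 - x * ↑u⁻¹ = y * ↑u⁻¹ := by
      rw [sub_eq_iff_eq_add', ← add_mul, ← hu, Units.mul_inv]
    rw [h2] at h1
    obtain ⟨v, hv⟩ := h1
    exact (not_isNilpotent_of_mul_eq_one (x := y * ↑u⁻¹) (y := ↑v⁻¹)
      (by rw [← hv, Units.mul_inv])).1
      (hmul y _ hy)
  have hscalar : ∀ c : K, IsNilpotent (algebraMap K E c) → c = 0 := by
    intro c hc
    by_contra hc0
    refine (not_isNilpotent_of_mul_eq_one (x := algebraMap K E c) (y := algebraMap K E c⁻¹) ?_).1 hc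
    rw [← map_mul, mul_inv_cancel₀ hc0, map_one]
  have huniq : ∀ (e : E) (c d : K), IsNilpotent (e - algebraMap K E c) →
      IsNilpotent (e - algebraMap K E d) → c = d := by
    intro e c d hc hd
    have := hadd _ _ hd hc.neg
    rw [← sub_eq_add_neg, sub_sub_sub_cancel_left, ← map_sub] at this
    exact sub_eq_zero.1 (hscalar _ this)
  choose c hc using h
  let χ : E →ₗ[K] K :=
    { toFun := c
      map_add' := fun x y => huniq (x + y) _ _ (hc _) (by
        rw [map_add, add_sub_add_comm]
        exact hadd _ _ (hc x) (hc y))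
      map_smul' := fun a x => huniq (a • x) _ _ (hc _) (by
        have h1 : a • x - algebraMap K E (a • c x)
            = (x - algebraMap K E (c x)) * algebraMap K E a := by
          rw [sub_mul, ← Algebra.commutes a x, Algebra.smul_def, smul_eq_mul, map_mul,
            Algebra.commutes a (algebraMap K E (c x))]
        rw [RingHom.id_apply, h1]
        exact hmul _ _ (hc x)) }
  refine ⟨AlgHom.ofLinearMap χ (huniq 1 _ _ (hc 1) (by simp))
    fun x y => huniq (x * y) _ _ (hc _) ?_, fun e he => ?_⟩
  · have h1 : x * y - algebraMap K E (c x * c y)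
        = (x - algebraMap K E (c x)) * y + (y - algebraMap K E (c y)) * algebraMap K E (c x) := by
      rw [map_mul, sub_mul, sub_mul, ← Algebra.commutes (c x) y,
        ← Algebra.commutes (c x) (algebraMap K E (c y))]
      abel
    exact h1 ▸ hadd _ _ (hmul _ _ (hc x)) (hmul _ _ (hc y))
  · have h1 : c e = 0 := he
    simpa [h1] using hc e

variable [Module.Finite K E]

attribute [local instance] dualCoalgebra

/-- Characters of a finite dimensional algebra are grouplike elements of its dual coalgebra. -/
theorem isGroupLikeElem_dual (χ : E →ₐ[K] K) : IsGroupLikeElem K (χ.toLinearMap : Dual K E) where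
  counit_eq_one := map_one χ
  comul_eq_tmul_self := by
    apply (TensorProduct.dualDistribEquiv K E E).injective
    apply TensorProduct.ext'
    intro x y
    have h1 := dualDistrib_dualComul (χ.toLinearMap : Dual K E) x y
    refine Eq.trans h1 ?_
    exact map_mul χ x y

/-- The convolution powers of the evaluation functional at `e` are the evaluations at the powers
of `e`. -/
theorem convPow_eval (e : E) (n : ℕ) (a : Dual K E) :
    convPow (C := Dual K E) (Dual.eval K E e) n a = a (e ^ n) := by
  induction n generalizing a with
  | zero => rw [pow_zero]; rfl
  | succ n ih =>
    rw [convPow_succ_apply, pow_succ]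
    refine Eq.trans ?_ (dualDistrib_dualComul a (e ^ n) e)
    generalize dualComul K E a = t
    change LinearMap.mul' K K (TensorProduct.map _ _ t) = _
    induction t with
    | zero => simp
    | tmul b c => simp [ih]
    | add s t hs ht => simp only [map_add, LinearMap.add_apply, hs, ht]

/-- If every element of `E` is the sum of a scalar and a nilpotent element, then a functional on
`E^*` which vanishes on the grouplike elements is nilpotent in the convolution algebra. -/
theorem exists_convPow_eq_zero [Nontrivial E]
    (h : ∀ e : E, ∃ c : K, IsNilpotent (e - algebraMap K E c)) (f : Dual K (Dual K E))
    (hf : ∀ a : Dual K E, IsGroupLikeElem K a → f a = 0) :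
    ∃ N, ∀ n ≥ N, convPow f n = 0 := by
  obtain ⟨χ, hχ⟩ := exists_algHom_isNilpotent h
  obtain ⟨e, rfl⟩ := (Module.evalEquiv K E).surjective f
  obtain ⟨N, hN⟩ := hχ e (hf _ (isGroupLikeElem_dual χ))
  refine ⟨N, fun n hn => LinearMap.ext fun a => ?_⟩
  refine (convPow_eval e n a).trans ?_
  rw [pow_eq_zero_of_le hn hN, map_zero, LinearMap.zero_apply]

end LocalAlgebra

/-! ### Endomorphisms of indecomposable comodules -/

section Endomorphisms

variable {K C M N : Type u} [Field K] [AddCommGroup C] [Module K C] [Coalgebra K C]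
  [AddCommGroup M] [Module K M] [RightComodule K C M]
  [AddCommGroup N] [Module K N] [RightComodule K C N]

theorem isSubcomodule_top : IsSubcomodule C (⊤ : Submodule K M) :=
  isSubcomodule_iff.2 fun _ _ _ => Submodule.mem_top

theorem IsComoduleHom.contractRight_coact {f : M →ₗ[K] N} (hf : IsComoduleHom C f) (h : Dual K C)
    (x : M) : contractRight h (coact K C N (f x)) = f (contractRight h (coact K C M x)) := by
  rw [← contractRight_rTensor]
  exact congrArg _ (LinearMap.congr_fun hf x)

theorem IsComoduleHom.isSubcomodule_ker {f : M →ₗ[K] N} (hf : IsComoduleHom C f) :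
    IsSubcomodule C (LinearMap.ker f) := by
  refine isSubcomodule_iff.2 fun x hx h => ?_
  rw [LinearMap.mem_ker] at *
  rw [← hf.contractRight_coact, hx, map_zero, map_zero]

theorem IsComoduleHom.isSubcomodule_range {f : M →ₗ[K] N} (hf : IsComoduleHom C f) :
    IsSubcomodule C (LinearMap.range f) := by
  rw [LinearMap.range_eq_map]
  exact isSubcomodule_top.map hf

theorem IsIndecomposable.nontrivial_endOp (h : IsIndecomposable K C M) :
    Nontrivial (EndOp K C M) := by
  have := h.1
  infer_instance

variable [Module.Finite K M]

/-- Fitting's lemma: an endomorphism of an indecomposable finite dimensional comodule which is not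
injective is nilpotent. -/
theorem IsIndecomposable.isNilpotent (h : IsIndecomposable K C M) (f : comoduleEnd K C M)
    (hf : LinearMap.ker f.1 ≠ ⊥) : IsNilpotent f := by
  obtain ⟨n, hn⟩ := Filter.eventually_atTop.1
    (LinearMap.eventually_isCompl_ker_pow_range_pow f.1)
  have hc := hn (n + 1) (Nat.le_succ n)
  have hpow : IsComoduleHom C (f.1 ^ (n + 1)) := (f ^ (n + 1)).2
  rcases h.2 _ _ hpow.isSubcomodule_ker hpow.isSubcomodule_range hc with h1 | h1
  · refine absurd (eq_bot_iff.2 fun x hx => ?_) hf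
    rw [← h1, LinearMap.mem_ker, pow_succ, Module.End.mul_apply, LinearMap.mem_ker.1 hx, map_zero]
  · exact ⟨n + 1, Subtype.ext (LinearMap.range_eq_bot.1 h1)⟩

variable [IsAlgClosed K]

/-- Over an algebraically closed field, an endomorphism of an indecomposable finite dimensional
comodule is the sum of a scalar, namely one of its eigenvalues, and a nilpotent endomorphism. -/
theorem IsIndecomposable.exists_isNilpotent_sub (h : IsIndecomposable K C M) (e : EndOp K C M) :
    ∃ c : K, IsNilpotent (e - algebraMap K (EndOp K C M) c) := by
  have := h.1
  obtain ⟨c, hc⟩ := Module.End.exists_eigenvalue (e.unop.1 : Module.End K M)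
  obtain ⟨n, hn⟩ := h.isNilpotent (e.unop - algebraMap K (comoduleEnd K C M) c) (by
    have h1 := hc
    rw [Module.End.hasEigenvalue_iff, Module.End.eigenspace_def] at h1
    exact h1)
  refine ⟨c, n, MulOpposite.unop_injective ?_⟩
  rw [MulOpposite.unop_pow, MulOpposite.unop_sub, MulOpposite.unop_zero]
  exact hn

end Endomorphisms

/-! ### The coalgebra `C^∨` -/

section VeeStep

variable {K C : Type u} [Field K] [AddCommGroup C] [Module K C] [Coalgebra K C]
  (R : IndecReps K C)

theorem Vee.hom_ext {P : Type u} [AddCommGroup P] [Module K P] {a b : Vee R →ₗ[K] P}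
    (hC : a ∘ₗ (veeIdeal R).mkQ ∘ₗ VeeTilde.inC R = b ∘ₗ (veeIdeal R).mkQ ∘ₗ VeeTilde.inC R)
    (hA : ∀ i, a ∘ₗ (veeIdeal R).mkQ ∘ₗ VeeTilde.inA R i
      = b ∘ₗ (veeIdeal R).mkQ ∘ₗ VeeTilde.inA R i)
    (hM : ∀ i, a ∘ₗ (veeIdeal R).mkQ ∘ₗ VeeTilde.inM R i
      = b ∘ₗ (veeIdeal R).mkQ ∘ₗ VeeTilde.inM R i) : a = b :=
  Submodule.linearMap_qext _ (VeeTilde.hom_ext hC hA hM)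

theorem Vee.comul_mkQ : Coalgebra.comul (R := K) (A := Vee R) ∘ₗ (veeIdeal R).mkQ
    = TensorProduct.map (veeIdeal R).mkQ (veeIdeal R).mkQ ∘ₗ VeeTilde.comul R :=
  (Coalgebra.Quotient.mkQCoalgHom (veeIdeal R)).map_comp_comul.symm

theorem toVee_toLinearMap : (toVee R).toLinearMap = (veeIdeal R).mkQ ∘ₗ VeeTilde.inC R := rfl

variable {R} in
/-- A comodule morphism on `C^∨` may be checked on the summands of `C^~`. The coaction `ρ` takes
values in `M ⊗ L` for a space `L` that receives a linear map from `C^∨`. -/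
theorem Vee.comp_eq_map_comul {M L : Type u} [AddCommGroup M] [Module K M] [AddCommGroup L]
    [Module K L] {ρ : M →ₗ[K] M ⊗[K] L} {h : Vee R →ₗ[K] L} {F : Vee R →ₗ[K] M}
    (hC : ρ ∘ₗ F ∘ₗ (toVee R).toLinearMap = TensorProduct.map (F ∘ₗ (toVee R).toLinearMap)
      (h ∘ₗ (toVee R).toLinearMap) ∘ₗ Coalgebra.comul)
    (hA : ∀ i, F ∘ₗ (veeIdeal R).mkQ ∘ₗ VeeTilde.inA R i = 0)
    (hM : ∀ i, ρ ∘ₗ F ∘ₗ (veeIdeal R).mkQ ∘ₗ VeeTilde.inM R i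
      = TensorProduct.map (F ∘ₗ (veeIdeal R).mkQ ∘ₗ VeeTilde.inM R i)
        (h ∘ₗ (toVee R).toLinearMap) ∘ₗ coact K C (R.M i)) :
    ρ ∘ₗ F = TensorProduct.map F h ∘ₗ Coalgebra.comul := by
  have key : ∀ {X : Type u} [AddCommGroup X] [Module K X] (j : X →ₗ[K] VeeTilde R),
      (TensorProduct.map F h ∘ₗ Coalgebra.comul) ∘ₗ (veeIdeal R).mkQ ∘ₗ j
        = TensorProduct.map (F ∘ₗ (veeIdeal R).mkQ) (h ∘ₗ (veeIdeal R).mkQ)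
          ∘ₗ (VeeTilde.comul R ∘ₗ j) := by
    intro X _ _ j
    rw [LinearMap.comp_assoc, ← LinearMap.comp_assoc j, Vee.comul_mkQ, TensorProduct.map_comp]
    simp only [LinearMap.comp_assoc]
  apply Vee.hom_ext
  · rw [key, VeeTilde.comul_inC, ← LinearMap.comp_assoc Coalgebra.comul, ← TensorProduct.map_comp]
    exact hC
  · intro i
    rw [key, VeeTilde.comul_inA, ← LinearMap.comp_assoc Coalgebra.comul, ← TensorProduct.map_comp,
      LinearMap.comp_assoc _ _ F, hA, LinearMap.comp_assoc, hA, TensorProduct.map_zero_left,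
      LinearMap.zero_comp, LinearMap.comp_zero]
  · intro i
    rw [key, VeeTilde.comul_inM, LinearMap.comp_add,
      ← LinearMap.comp_assoc (leftCoact _ _ _), ← LinearMap.comp_assoc (coact _ _ _),
      ← TensorProduct.map_comp, ← TensorProduct.map_comp, LinearMap.comp_assoc _ _ F, hA,
      TensorProduct.map_zero_left, LinearMap.zero_comp, zero_add]
    exact hM i

open Classical in
/-- Every representative `M` is a quotient of `C^∨`, by the projection of `C^~` onto the summand
`M`; this projection vanishes on `C`. -/
theorem Vee.exists_projection (i : R.ι) : ∃ q : Vee R →ₗ[K] R.M i, Function.Surjective q ∧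
    q ∘ₗ (toVee R).toLinearMap = 0 ∧
    (toVee R).toLinearMap.lTensor (R.M i) ∘ₗ coact K C (R.M i) ∘ₗ q
      = q.rTensor (Vee R) ∘ₗ Coalgebra.comul := by
  let p : VeeTilde R →ₗ[K] R.M i :=
    VeeTilde.desc 0 (fun _ => 0) (Pi.single (M := fun j => R.M j →ₗ[K] R.M i) i LinearMap.id)
  have hpC : p ∘ₗ VeeTilde.inC R = 0 := VeeTilde.desc_inC _ _ _
  have hpA : ∀ j, p ∘ₗ VeeTilde.inA R j = 0 := VeeTilde.desc_inA _ _ _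
  have hpM : ∀ j, p ∘ₗ VeeTilde.inM R j
      = Pi.single (M := fun j => R.M j →ₗ[K] R.M i) i LinearMap.id j := VeeTilde.desc_inM _ _ _
  have hp : veeIdeal R ≤ LinearMap.ker p := by
    refine Submodule.span_le.2 ?_
    rintro _ ⟨g, j, a, _, _, rfl⟩
    have h1 := LinearMap.congr_fun hpC g
    have h2 := LinearMap.congr_fun (hpA j) a
    rw [LinearMap.comp_apply] at h1 h2
    rw [SetLike.mem_coe, LinearMap.mem_ker, map_sub, h1, h2]
    simp
  let q : Vee R →ₗ[K] R.M i := (veeIdeal R).liftQ p hp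
  have hq : q ∘ₗ (veeIdeal R).mkQ = p := Submodule.liftQ_mkQ _ _ _
  have hqC : q ∘ₗ (toVee R).toLinearMap = 0 := by
    rw [toVee_toLinearMap, ← LinearMap.comp_assoc, hq, hpC]
  have hqM : ∀ j, q ∘ₗ (veeIdeal R).mkQ ∘ₗ VeeTilde.inM R j
      = Pi.single (M := fun j => R.M j →ₗ[K] R.M i) i LinearMap.id j := fun j => by
    rw [← LinearMap.comp_assoc, hq, hpM]
  refine ⟨q, fun m => ⟨(veeIdeal R).mkQ (VeeTilde.inM R i m), ?_⟩, hqC, ?_⟩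
  · have := LinearMap.congr_fun (hqM i) m
    rwa [Pi.single_eq_same] at this
  · rw [← LinearMap.comp_assoc]
    refine Vee.comp_eq_map_comul (h := LinearMap.id) ?_ (fun j => ?_) fun j => ?_
    · rw [hqC, LinearMap.comp_zero, TensorProduct.map_zero_left, LinearMap.zero_comp]
    · rw [← LinearMap.comp_assoc, hq, hpA]
    · rw [hqM]
      obtain rfl | hj := eq_or_ne j i
      · rw [Pi.single_eq_same]
        rfl
      · rw [Pi.single_eq_of_ne hj, LinearMap.comp_zero, TensorProduct.map_zero_left,
          LinearMap.zero_comp]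

/-- Every indecomposable finite dimensional comodule over `C` is a quotient of `C^∨`, by a morphism
that vanishes on `C`. -/
theorem Vee.exists_quotient {M : Type u} [AddCommGroup M] [Module K M] [RightComodule K C M]
    [Module.Finite K M] (hM : IsIndecomposable K C M) :
    ∃ q : Vee R →ₗ[K] M, Function.Surjective q ∧ q ∘ₗ (toVee R).toLinearMap = 0 ∧
    (toVee R).toLinearMap.lTensor M ∘ₗ coact K C M ∘ₗ q
      = q.rTensor (Vee R) ∘ₗ Coalgebra.comul := by
  obtain ⟨i, e, he⟩ := R.exists_iso M inferInstance hM
  obtain ⟨q, hsurj, hq0, hq⟩ := Vee.exists_projection R i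
  have hs : coact K C M ∘ₗ e.symm.toLinearMap = e.symm.toLinearMap.rTensor C ∘ₗ coact K C _ :=
    he.symm
  refine ⟨e.symm.toLinearMap ∘ₗ q, e.symm.surjective.comp hsurj, ?_, ?_⟩
  · rw [LinearMap.comp_assoc, hq0, LinearMap.comp_zero]
  · rw [← LinearMap.comp_assoc q, hs, LinearMap.comp_assoc q, ← LinearMap.comp_assoc,
      LinearMap.lTensor_comp_rTensor, ← LinearMap.rTensor_comp_lTensor, LinearMap.comp_assoc, hq,
      LinearMap.rTensor_comp, LinearMap.comp_assoc]

/-- The grouplike element of a pointed colocal coalgebra. -/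
noncomputable def IsPointedColocal.grouplike (hC : IsPointedColocal K C) : C :=
  Exists.choose (p := fun g => IsGroupLikeElem K g ∧ coradical K C = K ∙ g) hC

theorem IsPointedColocal.isGroupLikeElem_grouplike (hC : IsPointedColocal K C) :
    IsGroupLikeElem K hC.grouplike :=
  (Exists.choose_spec (p := fun g => IsGroupLikeElem K g ∧ coradical K C = K ∙ g) hC).1

variable (hC : IsPointedColocal K C)

/-- The retraction `C^∨ → C` which is the identity on `C`, sends `a ∈ A_M` to `ε(a) g`, and
vanishes on the representatives `M`. -/
noncomputable def Vee.retraction : Vee R →ₗ[K] C :=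
  (veeIdeal R).liftQ
    (VeeTilde.desc LinearMap.id
      (fun i => (Coalgebra.counit (R := K) (A := R.A i)).smulRight hC.grouplike) fun _ => 0) <| by
    refine Submodule.span_le.2 ?_
    rintro _ ⟨g, j, a, hg, ha, rfl⟩
    rw [SetLike.mem_coe, LinearMap.mem_ker, map_sub, ← LinearMap.comp_apply, ← LinearMap.comp_apply,
      VeeTilde.desc_inC, VeeTilde.desc_inA, LinearMap.id_apply, LinearMap.smulRight_apply,
      ha.counit_eq_one, one_smul, sub_eq_zero]
    exact hC.eq_of_isGroupLikeElem hg hC.isGroupLikeElem_grouplike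

theorem Vee.retraction_mkQ : Vee.retraction R hC ∘ₗ (veeIdeal R).mkQ
    = VeeTilde.desc LinearMap.id
      (fun i => (Coalgebra.counit (R := K) (A := R.A i)).smulRight hC.grouplike) fun _ => 0 :=
  Submodule.liftQ_mkQ _ _ _

theorem Vee.retraction_toVee :
    Vee.retraction R hC ∘ₗ (toVee R).toLinearMap = LinearMap.id := by
  rw [toVee_toLinearMap, ← LinearMap.comp_assoc, Vee.retraction_mkQ,
    VeeTilde.desc_inC]

theorem toVee_injective (hC : IsPointedColocal K C) : Function.Injective (toVee R) :=
  fun x y h => by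
    have h1 := LinearMap.congr_fun (Vee.retraction_toVee R hC) x
    have h2 := LinearMap.congr_fun (Vee.retraction_toVee R hC) y
    rw [LinearMap.comp_apply] at h1 h2
    exact h1.symm.trans ((congrArg _ h).trans h2)

/-- A comodule morphism on `C` which vanishes at the grouplike element extends to a comodule
morphism on `C^∨`, because it may be continued by zero. -/
theorem Vee.comp_retraction_eq {M L : Type u} [AddCommGroup M] [Module K M] [AddCommGroup L]
    [Module K L] {ρ : M →ₗ[K] M ⊗[K] L} (h : Vee R →ₗ[K] L) {F : C →ₗ[K] M}
    (hg : ∀ g, IsGroupLikeElem K g → F g = 0)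
    (hF : ρ ∘ₗ F = TensorProduct.map F (h ∘ₗ (toVee R).toLinearMap) ∘ₗ Coalgebra.comul) :
    ρ ∘ₗ (F ∘ₗ Vee.retraction R hC)
      = TensorProduct.map (F ∘ₗ Vee.retraction R hC) h ∘ₗ Coalgebra.comul := by
  have h1 : (F ∘ₗ Vee.retraction R hC) ∘ₗ (toVee R).toLinearMap = F := by
    rw [LinearMap.comp_assoc, Vee.retraction_toVee, LinearMap.comp_id]
  have h2 : ∀ i, (F ∘ₗ Vee.retraction R hC) ∘ₗ (veeIdeal R).mkQ ∘ₗ VeeTilde.inA R i = 0 := by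
    intro i
    rw [LinearMap.comp_assoc, ← LinearMap.comp_assoc _ _ (Vee.retraction R hC), Vee.retraction_mkQ,
      VeeTilde.desc_inA]
    ext a
    simp [hg _ hC.isGroupLikeElem_grouplike]
  have h3 : ∀ i, (F ∘ₗ Vee.retraction R hC) ∘ₗ (veeIdeal R).mkQ ∘ₗ VeeTilde.inM R i = 0 := by
    intro i
    rw [LinearMap.comp_assoc, ← LinearMap.comp_assoc _ _ (Vee.retraction R hC), Vee.retraction_mkQ,
      VeeTilde.desc_inM, LinearMap.comp_zero]
  refine Vee.comp_eq_map_comul ?_ h2 fun i => ?_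
  · rw [h1, hF]
  · rw [h3, LinearMap.comp_zero, TensorProduct.map_zero_left, LinearMap.zero_comp]

/-- A functional on `C^~` which vanishes on `C` and on the grouplike elements of the `A_M` is
locally nilpotent in the convolution algebra. -/
theorem VeeTilde.exists_convPow_eq_zero [IsAlgClosed K] {F : Dual K (VeeTilde R)}
    (hFC : F ∘ₗ VeeTilde.inC R = 0)
    (hFA : ∀ i a, IsGroupLikeElem K a → F (VeeTilde.inA R i a) = 0) (y : VeeTilde R) :
    ∃ N, ∀ n ≥ N, convPow F n y = 0 := by
  let S : Submodule K (VeeTilde R) :=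
    { carrier := {y | ∃ N, ∀ n ≥ N, convPow F n y = 0}
      zero_mem' := ⟨0, fun n _ => map_zero _⟩
      add_mem' := by
        rintro x y ⟨N, hN⟩ ⟨N', hN'⟩
        refine ⟨max N N', fun n hn => ?_⟩
        rw [map_add, hN n (le_of_max_le_left hn), hN' n (le_of_max_le_right hn), add_zero]
      smul_mem' := by
        rintro c x ⟨N, hN⟩
        exact ⟨N, fun n hn => by rw [map_smul, hN n hn, smul_zero]⟩ }
  have hA : ∀ i, ∃ N, ∀ n ≥ N, convPow F n ∘ₗ VeeTilde.inA R i = 0 := by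
    intro i
    have := (R.indecomposable i).nontrivial_endOp
    obtain ⟨N, hN⟩ := CoalgGen.exists_convPow_eq_zero
      (R.indecomposable i).exists_isNilpotent_sub (F ∘ₗ VeeTilde.inA R i) (hFA i)
    exact ⟨N, fun n hn => (convPow_comp (VeeTilde.inAHom R i) F n).trans (hN n hn)⟩
  have hS : S.mkQ = 0 := by
    apply VeeTilde.hom_ext
    · ext c
      rw [LinearMap.zero_comp, LinearMap.zero_apply, LinearMap.comp_apply, Submodule.mkQ_apply,
        Submodule.Quotient.mk_eq_zero]
      refine ⟨1, fun n hn => ?_⟩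
      obtain ⟨k, rfl⟩ := Nat.exists_eq_add_of_le' hn
      have h1 : convPow F (k + 1) ∘ₗ VeeTilde.inC R = 0 := by
        refine (convPow_comp (VeeTilde.inCHom R) F (k + 1)).trans ?_
        have h2 : F ∘ₗ (VeeTilde.inCHom R).toLinearMap = 0 := hFC
        rw [h2, convPow, TensorProduct.map_zero_right, LinearMap.zero_comp, LinearMap.comp_zero]
      exact LinearMap.congr_fun h1 c
    · intro i
      obtain ⟨N, hN⟩ := hA i
      ext a
      rw [LinearMap.zero_comp, LinearMap.zero_apply, LinearMap.comp_apply, Submodule.mkQ_apply,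
        Submodule.Quotient.mk_eq_zero]
      exact ⟨N, fun n hn => LinearMap.congr_fun (hN n hn) a⟩
    · intro i
      obtain ⟨N, hN⟩ := hA i
      ext m
      rw [LinearMap.zero_comp, LinearMap.zero_apply, LinearMap.comp_apply, Submodule.mkQ_apply,
        Submodule.Quotient.mk_eq_zero]
      refine ⟨N + 1, fun n hn => ?_⟩
      obtain ⟨k, rfl⟩ := Nat.exists_eq_add_of_le' (Nat.one_le_of_lt hn)
      have hk : N ≤ k := Nat.le_of_succ_le_succ hn
      -- one factor of each of the two summands of `δ(m)` is killed
      have h1 : convPow F (k + 1) ∘ₗ VeeTilde.inM R i = 0 := by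
        have h2 : Coalgebra.comul (R := K) ∘ₗ VeeTilde.inM R i = _ := VeeTilde.comul_inM R i
        rw [convPow, LinearMap.comp_assoc, LinearMap.comp_assoc, h2, LinearMap.comp_add,
          ← LinearMap.comp_assoc (leftCoact _ _ _), ← LinearMap.comp_assoc (coact _ _ _),
          ← TensorProduct.map_comp, ← TensorProduct.map_comp, hN k hk, hFC,
          TensorProduct.map_zero_left, TensorProduct.map_zero_right, LinearMap.zero_comp,
          LinearMap.zero_comp, add_zero, LinearMap.comp_zero]
      exact LinearMap.congr_fun h1 m
  have hy : S.mkQ y = 0 := by rw [hS, LinearMap.zero_apply]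
  rwa [Submodule.mkQ_apply, Submodule.Quotient.mk_eq_zero] at hy

theorem IsSubcoalgebra.exists_counit_ne_zero {D : Submodule K C} (hD : IsSubcoalgebra K D)
    (h0 : D ≠ ⊥) : ∃ x ∈ D, Coalgebra.counit (R := K) x ≠ 0 := by
  by_contra! h
  refine h0 ((Submodule.eq_bot_iff _).2 fun x hx => ?_)
  obtain ⟨s, hs⟩ := hD x hx
  have h1 : (Coalgebra.counit (R := K) (A := C)) ∘ₗ D.subtype = 0 := by
    ext y
    exact h y y.2
  have h2 : (contractLeft (0 : Dual K D) : D ⊗[K] D →ₗ[K] D) = 0 := by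
    ext; simp
  rw [← contractLeft_counit_comul (K := K) x, ← hs, contractLeft_map, h1, h2]
  simp

/-- If `C` is pointed colocal, then so is `C^∨`. A subcoalgebra that does not meet `C` would carry
a functional which is locally nilpotent and restricts to the counit. -/
theorem IsPointedColocal.vee [IsAlgClosed K] (hC : IsPointedColocal K C) :
    IsPointedColocal K (Vee R) := by
  obtain ⟨g, hg, hgD⟩ := isPointedColocal_iff.1 hC
  refine isPointedColocal_iff.2 ⟨toVee R g, hg.map (toVee R), fun D hD h0 => ?_⟩
  by_contra hgn
  have hbot : D.comap (toVee R).toLinearMap = ⊥ := by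
    by_contra h
    exact hgn (hgD _ (hD.comap (toVee R) (toVee_injective R hC)) h)
  let Q := LinearMap.range (toVee R).toLinearMap
  have hker : LinearMap.ker (Q.mkQ ∘ₗ D.subtype) = ⊥ := by
    refine (Submodule.eq_bot_iff _).2 fun x hx => ?_
    rw [LinearMap.mem_ker, LinearMap.comp_apply, Submodule.mkQ_apply,
      Submodule.Quotient.mk_eq_zero] at hx
    obtain ⟨c, hc⟩ := hx
    have h1 : c ∈ D.comap (toVee R).toLinearMap := by
      rw [Submodule.mem_comap, hc]
      exact x.2
    rw [hbot, Submodule.mem_bot] at h1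
    rw [h1, map_zero] at hc
    exact Subtype.ext hc.symm
  obtain ⟨r, hr⟩ := (Q.mkQ ∘ₗ D.subtype).exists_leftInverse_of_injective hker
  let f : Dual K (Vee R) := Coalgebra.counit ∘ₗ D.subtype ∘ₗ r ∘ₗ Q.mkQ
  have hfD : ∀ x ∈ D, f x = Coalgebra.counit (R := K) x := fun x hx =>
    congrArg (fun y : D => Coalgebra.counit (R := K) (y : Vee R))
      (LinearMap.congr_fun hr ⟨x, hx⟩)
  have hfC : f ∘ₗ (toVee R).toLinearMap = 0 := by
    ext c
    have : Q.mkQ ((toVee R).toLinearMap c) = 0 := by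
      rw [Submodule.mkQ_apply, Submodule.Quotient.mk_eq_zero]
      exact ⟨c, rfl⟩
    simp only [f, LinearMap.comp_apply, this, map_zero, LinearMap.zero_apply]
  obtain ⟨x, hx, hx0⟩ := hD.exists_counit_ne_zero h0
  obtain ⟨y, rfl⟩ := Submodule.mkQ_surjective _ x
  obtain ⟨N, hN⟩ := VeeTilde.exists_convPow_eq_zero R (F := f ∘ₗ (veeIdeal R).mkQ) hfC
    (fun i a ha => by
      have h1 : (veeIdeal R).mkQ (VeeTilde.inC R g) = (veeIdeal R).mkQ (VeeTilde.inA R i a) :=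
        (Submodule.Quotient.eq _).2 (Submodule.subset_span ⟨g, i, a, hg, ha, rfl⟩)
      rw [LinearMap.comp_apply, ← h1]
      exact LinearMap.congr_fun hfC g) y
  apply hx0
  rw [← convPow_eq_counit hD hfD N hx, ← hN N le_rfl]
  exact LinearMap.congr_fun
    (convPow_comp (Coalgebra.Quotient.mkQCoalgHom (veeIdeal R)) f N) y

end VeeStep

/-! ### The generating condition -/

section Generating

variable {K C : Type u} [Field K] [AddCommGroup C] [Module K C] [Coalgebra K C]

variable (K C) in
/-- The part of a comodule `M` which is generated by `C`: the sum of the images of all comodule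
morphisms `C → M`. -/
def homSpan (M : Type u) [AddCommGroup M] [Module K M] [RightComodule K C M] : Submodule K M :=
  ⨆ f : {f : C →ₗ[K] M // IsComoduleHom C f}, LinearMap.range f.1

variable {M N : Type u} [AddCommGroup M] [Module K M] [RightComodule K C M]
  [AddCommGroup N] [Module K N] [RightComodule K C N]

theorem range_le_homSpan {f : C →ₗ[K] M} (hf : IsComoduleHom C f) :
    LinearMap.range f ≤ homSpan K C M :=
  le_iSup (fun f : {f : C →ₗ[K] M // IsComoduleHom C f} => LinearMap.range f.1) ⟨f, hf⟩

theorem map_homSpan_le {a : M →ₗ[K] N} (ha : IsComoduleHom C a) :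
    (homSpan K C M).map a ≤ homSpan K C N := by
  rw [homSpan, Submodule.map_iSup]
  refine iSup_le fun f => ?_
  rw [← LinearMap.range_comp]
  exact range_le_homSpan (ha.comp f.2)

theorem IsSubcomodule.le_homSpan {P : Submodule K M} (hP : IsSubcomodule C P)
    (h : letI := hP.comodule; homSpan K C P = ⊤) : P ≤ homSpan K C M := by
  let := hP.comodule
  have h1 := map_homSpan_le hP.isComoduleHom_subtype
  rwa [h, Submodule.map_top, Submodule.range_subtype] at h1

/-- Finite dimensional comodules are generated by `C` if the indecomposable ones are quotients of
`C`, since they decompose into indecomposable ones. -/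
theorem homSpan_eq_top_of_finite
    (h : ∀ (M : Type u) [AddCommGroup M] [Module K M] [RightComodule K C M], Module.Finite K M →
      IsIndecomposable K C M → IsQuotientComodule K C C M) (n : ℕ) :
    ∀ (M : Type u) [AddCommGroup M] [Module K M] [RightComodule K C M], Module.Finite K M →
      Module.finrank K M = n → homSpan K C M = ⊤ := by
  induction n using Nat.strong_induction_on with
  | _ n ih =>
    intro M _ _ _ _ hn
    by_cases hM : IsIndecomposable K C M
    · obtain ⟨f, hf, hsurj⟩ := h M inferInstance hM
      rw [eq_top_iff, ← LinearMap.range_eq_top.2 hsurj]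
      exact range_le_homSpan hf
    rcases subsingleton_or_nontrivial M with hs | hs
    · exact Subsingleton.elim _ _
    have hlt : ∀ P Q : Submodule K M, IsSubcomodule C P → IsCompl P Q → Q ≠ ⊥ →
        P ≤ homSpan K C M := by
      intro P Q hP hPQ hQ
      let := hP.comodule
      refine hP.le_homSpan (ih _ ?_ P inferInstance rfl)
      rw [← hn]
      refine Submodule.finrank_lt fun hP' => hQ ?_
      rw [hP'] at hPQ
      exact eq_bot_of_top_isCompl hPQ
    have hM' : ¬ ∀ P Q : Submodule K M, IsSubcomodule C P → IsSubcomodule C Q →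
      IsCompl P Q → P = ⊥ ∨ Q = ⊥ := fun h' => hM ⟨hs, h'⟩
    push Not at hM'
    obtain ⟨P, Q, hP, hQ, hPQ, hP0, hQ0⟩ := hM'
    rw [eq_top_iff, ← hPQ.sup_eq_top]
    exact sup_le (hlt P Q hP hPQ hQ0) (hlt Q P hQ hPQ.symm hP0)

/-- If all indecomposable finite dimensional right comodules are quotients of `C`, then `C` has the
right generating condition, because comodules are locally finite. -/
theorem rightGeneratingCondition_of_isQuotientComodule
    (h : ∀ (M : Type u) [AddCommGroup M] [Module K M] [RightComodule K C M], Module.Finite K M →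
      IsIndecomposable K C M → IsQuotientComodule K C C M) : RightGeneratingCondition K C := by
  intro M _ _ _
  have htop : homSpan K C M = ⊤ := by
    refine eq_top_iff.2 fun x _ => ?_
    obtain ⟨P, hfg, hP, hx⟩ := exists_finite_subcomodule (K := K) (C := C) x
    let := hP.comodule
    exact hP.le_homSpan (homSpan_eq_top_of_finite h _ P (Module.Finite.iff_fg.2 hfg) rfl) hx
  let F : ({f : C →ₗ[K] M // IsComoduleHom C f} →₀ C) →ₗ[K] M := Finsupp.lsum K fun f => f.1
  have hF : ∀ f : {f : C →ₗ[K] M // IsComoduleHom C f}, F ∘ₗ Finsupp.lsingle f = f.1 := by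
    intro f
    ext c
    simp [F]
  refine ⟨_, F, ?_, ?_⟩
  · refine Finsupp.lhom_ext' fun f => ?_
    have h1 : coact K C ({f : C →ₗ[K] M // IsComoduleHom C f} →₀ C) ∘ₗ Finsupp.lsingle f
        = (Finsupp.lsingle f).rTensor C ∘ₗ coact K C C := by
      ext c
      change Finsupp.lsum K (fun i => (Finsupp.lsingle i).rTensor C ∘ₗ coact K C C)
        (Finsupp.single f c) = _
      simp
    rw [LinearMap.comp_assoc, hF, LinearMap.comp_assoc, h1, ← LinearMap.comp_assoc,
      ← LinearMap.rTensor_comp, hF]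
    exact f.2
  · rw [← LinearMap.range_eq_top, eq_top_iff, ← htop]
    refine iSup_le fun f => ?_
    rw [← hF f]
    exact LinearMap.range_comp_le_range _ _

end Generating

/-! ### The union of the tower -/

section Union

variable {K : Type u} [Field K] (R : ∀ D : CoalgCat.{u} K, IndecReps K D)
  (C : Type u) [AddCommGroup C] [Module K C] [Coalgebra K C]

theorem towerMap_self (m : ℕ) : towerMap R C m m le_rfl = CoalgHom.id K _ :=
  Nat.leRec_self ..

theorem towerMap_succ {m n : ℕ} (h : m ≤ n) :
    towerMap R C m (n + 1) (h.trans n.le_succ) = (towerStep R C n).comp (towerMap R C m n h) :=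
  Nat.leRec_succ ..

theorem towerMap_self_succ (n : ℕ) : towerMap R C n (n + 1) n.le_succ = towerStep R C n := by
  rw [towerMap_succ R C le_rfl, towerMap_self]
  rfl

theorem towerMap_towerMap {k m n : ℕ} (h : k ≤ m) (h' : m ≤ n) (x : tower R C k) :
    towerMap R C m n h' (towerMap R C k m h x) = towerMap R C k n (h.trans h') x := by
  induction n, h' using Nat.le_induction with
  | base => rw [towerMap_self]; rfl
  | succ n h' ih =>
    rw [towerMap_succ R C h', towerMap_succ R C (h.trans h')]
    exact congrArg (towerStep R C n) ih

/-- `C^[n]` as a subcoalgebra of `C_∞^∨`. -/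
noncomputable def VeeInf.ofHom (n : ℕ) : tower R C n →ₗc[K] VeeInf R C :=
  { VeeInf.of R C n with
    counit_comp := VeeInf.counit_of R C n
    map_comp_comul := (VeeInf.comul_of R C n).symm }

variable {C} in
theorem VeeInf.exists_of (x : VeeInf R C) : ∃ n y, VeeInf.of R C n y = x :=
  Module.DirectLimit.exists_of x

theorem VeeInf.of_comp_towerStep (n : ℕ) :
    VeeInf.of R C (n + 1) ∘ₗ (towerStep R C n).toLinearMap = VeeInf.of R C n := by
  rw [← towerMap_self_succ]
  exact VeeInf.of_comp_towerMap R C n.le_succ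

/-- Every tensor over the union comes from some stage of the tower. -/
theorem VeeInf.exists_lTensor_of {M : Type u} [AddCommGroup M] [Module K M]
    (t : M ⊗[K] VeeInf R C) :
    ∃ N, ∀ n ≥ N, t ∈ LinearMap.range ((VeeInf.of R C n).lTensor M) := by
  induction t with
  | zero => exact ⟨0, fun n _ => zero_mem _⟩
  | tmul m x =>
    obtain ⟨N, y, rfl⟩ := VeeInf.exists_of R x
    refine ⟨N, fun n hn => ⟨m ⊗ₜ towerMap R C N n hn y, ?_⟩⟩
    rw [LinearMap.lTensor_tmul, VeeInf.of_towerMap]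
  | add s t hs ht =>
    obtain ⟨N, hN⟩ := hs
    obtain ⟨N', hN'⟩ := ht
    exact ⟨max N N', fun n hn =>
      add_mem (hN n (le_of_max_le_left hn)) (hN' n (le_of_max_le_right hn))⟩

/-- A finite dimensional comodule over the union is a comodule over some stage of the tower. -/
theorem VeeInf.exists_coact {M : Type u} [AddCommGroup M] [Module K M]
    [RightComodule K (VeeInf R C) M] [Module.Finite K M] :
    ∃ (n : ℕ) (ρ : M →ₗ[K] M ⊗[K] tower R C n),
      (VeeInf.of R C n).lTensor M ∘ₗ ρ = coact K (VeeInf R C) M := by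
  let b := Module.finBasis K M
  choose N hN using fun i => VeeInf.exists_lTensor_of R C (coact K (VeeInf R C) M (b i))
  let n := Finset.univ.sup N
  choose t ht using fun i => hN i n (Finset.le_sup (Finset.mem_univ i))
  refine ⟨n, b.constr K t, b.ext fun i => ?_⟩
  rw [LinearMap.comp_apply, Module.Basis.constr_basis, ht]

variable {C} [IsAlgClosed K]

theorem IsPointedColocal.tower (hC : IsPointedColocal K C) (n : ℕ) :
    IsPointedColocal K (tower R C n) := by
  induction n with
  | zero => exact hC
  | succ n ih => exact ih.vee (R (CoalgGen.tower R C n))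

theorem IsPointedColocal.towerMap_injective (hC : IsPointedColocal K C) {m n : ℕ} (h : m ≤ n) :
    Function.Injective (towerMap R C m n h) := by
  induction n, h using Nat.le_induction with
  | base => rw [towerMap_self]; exact Function.injective_id
  | succ n h ih =>
    rw [towerMap_succ R C h]
    exact (toVee_injective (R (CoalgGen.tower R C n)) (hC.tower R n)).comp ih

theorem IsPointedColocal.of_injective (hC : IsPointedColocal K C) (n : ℕ) :
    Function.Injective (VeeInf.of R C n) := by
  have : DirectedSystem (fun n => CoalgGen.tower R C n)
      (fun m n h => (towerMap R C m n h).toLinearMap) :=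
    ⟨fun m x => by rw [towerMap_self]; rfl, fun k m n h h' x => towerMap_towerMap R C _ _ x⟩
  refine (injective_iff_map_eq_zero _).2 fun x hx => ?_
  obtain ⟨m, hm, h0⟩ := Module.DirectLimit.of.zero_exact (R := K) (ι := ℕ)
    (G := fun n => CoalgGen.tower R C n)
    (f := fun m n h => (towerMap R C m n h).toLinearMap) hx
  exact hC.towerMap_injective R hm (h0.trans (map_zero _).symm)

theorem IsPointedColocal.veeInf (hC : IsPointedColocal K C) : IsPointedColocal K (VeeInf R C) := by
  obtain ⟨g, hg, _⟩ := isPointedColocal_iff.1 (hC.tower R 0)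
  refine isPointedColocal_iff.2 ⟨VeeInf.of R C 0 g, hg.map (VeeInf.ofHom R C 0), fun D hD h0 => ?_⟩
  obtain ⟨x, hx, hx0⟩ := D.ne_bot_iff.1 h0
  obtain ⟨n, y, rfl⟩ := VeeInf.exists_of R x
  obtain ⟨g', hg', h⟩ := isPointedColocal_iff.1 (hC.tower R n)
  have h1 := h _ (hD.comap (VeeInf.ofHom R C n) (hC.of_injective R n)) (fun h => hx0 (by
    have : y ∈ D.comap (VeeInf.ofHom R C n).toLinearMap := hx
    rw [h, Submodule.mem_bot] at this
    rw [this, map_zero]))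
  rw [(hC.tower R n).eq_of_isGroupLikeElem hg' (hg.map (towerMap R C 0 n n.zero_le))] at h1
  rw [← VeeInf.of_towerMap R C n.zero_le]
  exact h1

open Classical in
/-- A comodule morphism on `C^[n+1]` which vanishes on `C^[n]` extends to `C_∞^∨`: it is continued
by zero from each stage to the next. -/
theorem IsPointedColocal.exists_extension (hC : IsPointedColocal K C) {M : Type u}
    [AddCommGroup M] [Module K M] [RightComodule K (VeeInf R C) M] {n : ℕ}
    {q : CoalgGen.tower R C (n + 1) →ₗ[K] M}
    (hq0 : q ∘ₗ (towerStep R C n).toLinearMap = 0)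
    (hq : coact K (VeeInf R C) M ∘ₗ q
      = TensorProduct.map q (VeeInf.of R C (n + 1)) ∘ₗ Coalgebra.comul) :
    ∃ F : VeeInf R C →ₗ[K] M, IsComoduleHom (VeeInf R C) F ∧ F ∘ₗ VeeInf.of R C (n + 1) = q := by
  -- the increments of the extension: `q` at the stage `n + 1`, and zero elsewhere
  let p : ∀ m, CoalgGen.tower R C (m + 1) →ₗ[K] M :=
    Pi.single (M := fun m => CoalgGen.tower R C (m + 1) →ₗ[K] M) n q
  have hp0 : ∀ m, p m ∘ₗ (towerStep R C m).toLinearMap = 0 := by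
    intro m
    obtain rfl | hm := eq_or_ne m n
    · rw [show p m = q from Pi.single_eq_same _ _, hq0]
    · rw [show p m = 0 from Pi.single_eq_of_ne hm _, LinearMap.zero_comp]
  have hp : ∀ m, coact K (VeeInf R C) M ∘ₗ p m
      = TensorProduct.map (p m) (VeeInf.of R C (m + 1)) ∘ₗ Coalgebra.comul := by
    intro m
    obtain rfl | hm := eq_or_ne m n
    · rw [show p m = q from Pi.single_eq_same _ _, hq]
    · rw [show p m = 0 from Pi.single_eq_of_ne hm _, LinearMap.comp_zero,
        TensorProduct.map_zero_left, LinearMap.zero_comp]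
  let r : ∀ m, CoalgGen.tower R C (m + 1) →ₗ[K] CoalgGen.tower R C m := fun m =>
    Vee.retraction (R (CoalgGen.tower R C m)) (hC.tower R m)
  have hr : ∀ m, r m ∘ₗ (towerStep R C m).toLinearMap = LinearMap.id := fun m =>
    Vee.retraction_toVee (R (CoalgGen.tower R C m)) (hC.tower R m)
  let F : ∀ m, CoalgGen.tower R C m →ₗ[K] M := fun m =>
    Nat.rec (motive := fun m => CoalgGen.tower R C m →ₗ[K] M) 0 (fun m F => F ∘ₗ r m + p m) m
  have hFs : ∀ m, F (m + 1) = F m ∘ₗ r m + p m := fun m => rfl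
  have hstep : ∀ m, F (m + 1) ∘ₗ (towerStep R C m).toLinearMap = F m := by
    intro m
    rw [hFs, LinearMap.add_comp, hp0, LinearMap.comp_assoc, hr, LinearMap.comp_id, add_zero]
  have hFg : ∀ m g, IsGroupLikeElem K g → F m g = 0 := by
    intro m
    induction m with
    | zero => exact fun g _ => rfl
    | succ m ih =>
      intro g hg
      have h1 := (hC.tower R m).isGroupLikeElem_grouplike
      rw [(hC.tower R (m + 1)).eq_of_isGroupLikeElem hg (h1.map (towerStep R C m))]
      exact (LinearMap.congr_fun (hstep m) _).trans (ih _ h1)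
  have hF : ∀ m, coact K (VeeInf R C) M ∘ₗ F m
      = TensorProduct.map (F m) (VeeInf.of R C m) ∘ₗ Coalgebra.comul := by
    intro m
    induction m with
    | zero =>
      rw [show F 0 = 0 from rfl, LinearMap.comp_zero, TensorProduct.map_zero_left,
        LinearMap.zero_comp]
    | succ m ih =>
      have h1 : coact K (VeeInf R C) M ∘ₗ (F m ∘ₗ r m)
          = TensorProduct.map (F m ∘ₗ r m) (VeeInf.of R C (m + 1)) ∘ₗ Coalgebra.comul := by
        refine Vee.comp_retraction_eq (R (CoalgGen.tower R C m)) (hC.tower R m)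
          (VeeInf.of R C (m + 1)) (hFg m) ?_
        have h2 := VeeInf.of_comp_towerStep R C m
        rw [ih]
        exact congrArg (fun h => TensorProduct.map (F m) h ∘ₗ Coalgebra.comul) h2.symm
      rw [hFs, LinearMap.comp_add, h1, hp, TensorProduct.map_add_left, LinearMap.add_comp]
  have hcompat : ∀ m k (h : m ≤ k) (x : CoalgGen.tower R C m),
      F k ((towerMap R C m k h).toLinearMap x) = F m x := by
    intro m k h x
    induction k, h using Nat.le_induction with
    | base => rw [towerMap_self]; rfl
    | succ k h ih =>
      rw [← ih, ← hstep k, towerMap_succ R C h]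
      rfl
  let G : VeeInf R C →ₗ[K] M := Module.DirectLimit.lift K ℕ (fun n => CoalgGen.tower R C n)
    (fun m n h => (towerMap R C m n h).toLinearMap) F hcompat
  have hG : ∀ m, G ∘ₗ VeeInf.of R C m = F m := fun m => LinearMap.ext fun x =>
    Module.DirectLimit.lift_of (R := K) (ι := ℕ) (G := fun n => CoalgGen.tower R C n)
      (f := fun m n h => (towerMap R C m n h).toLinearMap) F hcompat x
  have hF0 : ∀ m ≤ n, F m = 0 := by
    intro m
    induction m with
    | zero => exact fun _ => rfl
    | succ m ih =>
      intro hm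
      rw [hFs, ih (Nat.le_of_succ_le hm), LinearMap.zero_comp, zero_add]
      exact Pi.single_eq_of_ne (Nat.ne_of_lt hm) _
  refine ⟨G, VeeInf.hom_ext fun m => ?_, ?_⟩
  · have h1 : coact K (VeeInf R C) (VeeInf R C) ∘ₗ VeeInf.of R C m
        = TensorProduct.map (VeeInf.of R C m) (VeeInf.of R C m) ∘ₗ Coalgebra.comul :=
      VeeInf.comul_of R C m
    rw [LinearMap.comp_assoc, hG, hF, LinearMap.comp_assoc, h1, ← LinearMap.comp_assoc,
      LinearMap.rTensor_comp_map, hG]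
  · rw [hG, hFs, hF0 n le_rfl, LinearMap.zero_comp, zero_add]
    exact Pi.single_eq_same _ _

/-- The indecomposable comodule is already a comodule over some `C^[n]`, so it is a quotient of
`C^[n+1]`; the quotient map vanishes on `C^[n]` and extends to the union. -/
theorem IsPointedColocal.isQuotientComodule_veeInf (hC : IsPointedColocal K C) (M : Type u)
    [AddCommGroup M] [Module K M] [RightComodule K (VeeInf R C) M] (_ : Module.Finite K M)
    (hM : IsIndecomposable K (VeeInf R C) M) :
    IsQuotientComodule K (VeeInf R C) (VeeInf R C) M := by
  obtain ⟨n, ρ, hρ⟩ := VeeInf.exists_coact R C (M := M)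
  let : RightComodule K (CoalgGen.tower R C n) M :=
    comoduleOfInjective LinearMap.id (VeeInf.ofHom R C n) Function.injective_id
      (hC.of_injective R n) ρ hρ
  have hsub : ∀ P : Submodule K M, IsSubcomodule (CoalgGen.tower R C n) P →
      IsSubcomodule (VeeInf R C) P := by
    intro P hP
    rw [isSubcomodule_iff] at *
    intro x hx f
    rw [← hρ, LinearMap.comp_apply, LinearMap.lTensor, contractRight_map]
    exact hP x hx _
  obtain ⟨q, hsurj, hq0, hq⟩ : ∃ q : CoalgGen.tower R C (n + 1) →ₗ[K] M, Function.Surjective q ∧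
      q ∘ₗ (towerStep R C n).toLinearMap = 0 ∧
      (towerStep R C n).toLinearMap.lTensor M ∘ₗ ρ ∘ₗ q = q.rTensor _ ∘ₗ Coalgebra.comul :=
    Vee.exists_quotient (R (CoalgGen.tower R C n))
      ⟨hM.1, fun P Q hP hQ hPQ => hM.2 P Q (hsub P hP) (hsub Q hQ) hPQ⟩
  obtain ⟨F, hF, hFq⟩ := hC.exists_extension R hq0 <| by
    rw [← hρ, ← VeeInf.of_comp_towerStep, LinearMap.lTensor_comp, LinearMap.comp_assoc,
      LinearMap.comp_assoc, hq, ← LinearMap.comp_assoc, LinearMap.lTensor_comp_rTensor]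
  refine ⟨F, hF, fun m => ?_⟩
  obtain ⟨x, rfl⟩ := hsurj m
  exact ⟨VeeInf.of R C (n + 1) x, LinearMap.congr_fun hFq x⟩

end Union

end CoalgGen

theorem theorem4p9 {K : Type u} [Field K] [IsAlgClosed K]
    (R : ∀ D : CoalgCat.{u} K, CoalgGen.IndecReps K D)
    (C : Type u) [AddCommGroup C] [Module K C] [Coalgebra K C]
    (hC : CoalgGen.IsPointedColocal K C) :
    (∀ n, Function.Injective (CoalgGen.VeeInf.of R C n)) ∧
    CoalgGen.IsColocal K (CoalgGen.VeeInf R C) ∧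
    CoalgGen.IsPointedColocal K (CoalgGen.VeeInf R C) ∧
    (∀ (M : Type u) [AddCommGroup M] [Module K M]
      [CoalgGen.RightComodule K (CoalgGen.VeeInf R C) M], Module.Finite K M →
      CoalgGen.IsIndecomposable K (CoalgGen.VeeInf R C) M →
      CoalgGen.IsQuotientComodule K (CoalgGen.VeeInf R C) (CoalgGen.VeeInf R C) M) ∧
    CoalgGen.RightGeneratingCondition K (CoalgGen.VeeInf R C) :=
  ⟨hC.of_injective R, (hC.veeInf R).isColocal, hC.veeInf R, hC.isQuotientComodule_veeInf R,
    CoalgGen.rightGeneratingCondition_of_isQuotientComodule (hC.isQuotientComodule_veeInf R)⟩
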